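/- Let $a,b,c,d,e\in\mathbb C$ with $\Re d>0$, $\Re(e-a-d)>0$, $a\notin\mathbb Z$, $e-a\notin\mathbb Z$ and $e\notin\{0,-1,-2,\dots\}$. Horn's function $H_2$ is defined by $$H_2(a,b,c,d,e;x,y)=\sum_{i,j=0}^{\infty}\frac{(a)_{i-j}(b)_i(c)_j(d)_j}{(e)_i\,i!\,j!}\,x^iy^j\qquad\bigl(|x|<1,\ |y|<(|x|+1)^{-1}\bigr),$$ where $(a)_k=a(a+1)\cdots(a+k-1)$ for $k\ge 0$ and $(a)_k=(-1)^k/(1-a)_{-k}$ for $k<0$; outside this region $H_2(x,y)$ denotes the analytic continuation of the sum along the segment from $(0,0)$ to $(x,y)$. Let $\gamma$ be a Pochhammer double loop $(1+,0+,1-,0-)$, that is, a piecewise $C^1$ closed curve in $\mathbb C\setminus\{0,1\}$ which starts at a point of the interval $(0,1)$ and which, through closed curves in $\mathbb C\setminus\{0,1\}$ with base point in $(0,1)$, can be deformed into the curve that runs successively around $1$ and around $0$ in the positive sense, and then around $1$ and around $0$ in the negative sense. Let $(x,y)\in\mathbb C^2$ be such that $ux\notin[1,\infty)$ and $(u^{-1}-1)y\notin[1,\infty)$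 for all $u$ on $\gamma$. Then the analytic continuation defining $H_2(a,b,c,d,e;x,y)$ exists, the integrals below converge absolutely, and $$H_2(a,b,c,d,e;x,y)=\frac{\Gamma(e)}{\Gamma(e-a-d)\Gamma(a)\Gamma(d)}\,\frac{1}{(1-e^{2\pi i a})(1-e^{2\pi i(e-a)})}\int_\gamma u^{a-1}(1-u)^{e-a-1}(1-ux)^{-b}\left(\int_0^1 v^{d-1}(1-v)^{e-a-d-1}\bigl(1-(u^{-1}-1)vy\bigr)^{-c}\,dv\right)du.$$ Here $u^{a-1}$ and $(1-u)^{e-a-1}$ are continued along $\gamma$, starting with $\arg u=\arg(1-u)=0$, and all other powers have their principal values. -/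

import Mathlib

/-- The Pochhammer symbol `(a)_k` for an integer index `k`: `a (a + 1) ⋯ (a + k - 1)` for `k ≥ 0`,
and `(-1)^k / (1 - a)_{-k}` for `k < 0`. -/
noncomputable def pochhammerZ (a : ℂ) : ℤ → ℂ
  | Int.ofNat n => (ascPochhammer ℂ n).eval a
  | Int.negSucc n => (-1) ^ (n + 1) / (ascPochhammer ℂ (n + 1)).eval (1 - a)

/-- The `(i, j)`-th term of Horn's double power series `H₂(a, b, c, d, e; x, y)`. -/
noncomputable def hornH2Term (a b c d e x y : ℂ) (p : ℕ × ℕ) : ℂ :=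
  pochhammerZ a ((p.1 : ℤ) - (p.2 : ℤ)) * pochhammerZ b p.1 * pochhammerZ c p.2 * pochhammerZ d p.2
    / (pochhammerZ e p.1 * (p.1.factorial : ℂ) * (p.2.factorial : ℂ)) * x ^ p.1 * y ^ p.2

/-- The convergence region `|x| < 1`, `|y| < (|x| + 1)⁻¹` of the double power series. -/
def hornH2Region : Set (ℂ × ℂ) := {p | ‖p.1‖ < 1 ∧ ‖p.2‖ < (‖p.1‖ + 1)⁻¹}

/-- `w` is the value at `(x, y)` of Horn's function `H₂(a, b, c, d, e; ·, ·)`: there is an analytic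
function on an open set containing `(x, y)`, star-shaped about the origin, which is the sum of
the double power series at every point of its domain that lies in the convergence region, and which
takes the value `w` at `(x, y)`. So `w` is obtained by analytic continuation of the sum of the
series along the segment from `(0, 0)` to `(x, y)`. -/
def IsHornH2Value (a b c d e x y w : ℂ) : Prop :=
  ∃ (U : Set (ℂ × ℂ)) (F : ℂ × ℂ → ℂ), IsOpen U ∧ StarConvex ℝ 0 U ∧ (x, y) ∈ U ∧
    AnalyticOnNhd ℂ F U ∧
    (∀ p ∈ U ∩ hornH2Region, HasSum (hornH2Term a b c d e p.1 p.2) (F p)) ∧ F (x, y) = w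

/-- In the convergence region the value is the sum of the double power series. -/
theorem IsHornH2Value.hasSum {a b c d e x y w : ℂ} (h : IsHornH2Value a b c d e x y w)
    (hxy : (x, y) ∈ hornH2Region) : HasSum (hornH2Term a b c d e x y) w := by
  obtain ⟨U, F, -, -, hU, -, hF, rfl⟩ := h
  exact hF (x, y) ⟨hU, hxy⟩

/-- The value of the analytic continuation is unique. -/
theorem IsHornH2Value.unique {a b c d e x y w w' : ℂ} (h : IsHornH2Value a b c d e x y w)
    (h' : IsHornH2Value a b c d e x y w') : w = w' := by
  obtain ⟨U, F, hUo, hUs, hU, hFa, hF, rfl⟩ := h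
  obtain ⟨V, G, hVo, hVs, hV, hGa, hG, rfl⟩ := h'
  have hs : StarConvex ℝ 0 (U ∩ V) := hUs.inter hVs
  have h0 : (0 : ℂ × ℂ) ∈ U ∩ V := by
    have := hs.smul_mem ⟨hU, hV⟩ (t := 0) le_rfl zero_le_one
    simpa using this
  have hc : IsPreconnected (U ∩ V) := (hs.isPathConnected h0).isConnected.isPreconnected
  have hR : IsOpen hornH2Region := by
    have h1 : IsOpen {p : ℂ × ℂ | ‖p.1‖ < 1} := isOpen_lt (by fun_prop) (by fun_prop)
    have h2 : IsOpen {p : ℂ × ℂ | ‖p.2‖ < (‖p.1‖ + 1)⁻¹} := by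
      refine isOpen_lt (by fun_prop) (Continuous.inv₀ (by fun_prop) fun p => ?_)
      positivity
    exact h1.inter h2
  have hR0 : (0 : ℂ × ℂ) ∈ hornH2Region := by simp [hornH2Region]
  have hev : F =ᶠ[nhds 0] G := by
    filter_upwards [((hUo.inter hVo).inter hR).mem_nhds ⟨h0, hR0⟩] with p hp
    exact (hF p ⟨hp.1.1, hp.2⟩).unique (hG p ⟨hp.1.2, hp.2⟩)
  exact (hFa.mono Set.inter_subset_left).eqOn_of_preconnected_of_eventuallyEq
    (hGa.mono Set.inter_subset_right) hc h0 hev ⟨hU, hV⟩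

open Classical in
/-- Horn's function `H₂(a, b, c, d, e; x, y)`, analytically continued along the segment from the
origin to `(x, y)` (and `0` where this continuation does not exist). -/
noncomputable def hornH2 (a b c d e x y : ℂ) : ℂ :=
  if h : ∃ w, IsHornH2Value a b c d e x y w then h.choose else 0

theorem IsHornH2Value.hornH2_eq {a b c d e x y w : ℂ} (h : IsHornH2Value a b c d e x y w) :
    hornH2 a b c d e x y = w := by
  have hex : ∃ w, IsHornH2Value a b c d e x y w := ⟨w, h⟩
  rw [hornH2, dif_pos hex]
  exact hex.choose_spec.unique h

/-- `γ` is a piecewise continuously differentiable curve with parameter interval `[0, 1]`. -/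
def IsPiecewiseC1 (γ : ℝ → ℂ) : Prop :=
  ContinuousOn γ (Set.Icc 0 1) ∧
    ∃ (n : ℕ) (τ : ℕ → ℝ), Monotone τ ∧ τ 0 = 0 ∧ τ n = 1 ∧
      ∀ i < n, ContDiffOn ℝ 1 γ (Set.Icc (τ i) (τ (i + 1)))

/-- A model of the double loop `(1+, 0+, 1-, 0-)`: starting at `1/2`, run through the circle of
radius `1/2` around `1` in the positive sense, then through the circle of radius `1/2` around `0` in
the positive sense, then through the first one in the negative sense, and finally through
the second one in the negative sense. -/
noncomputable def modelDoubleLoop (t : ℝ) : ℂ :=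
  if t ≤ 1 / 4 then 1 - 1 / 2 * Complex.exp (2 * Real.pi * Complex.I * (4 * t))
  else if t ≤ 1 / 2 then 1 / 2 * Complex.exp (2 * Real.pi * Complex.I * (4 * t))
  else if t ≤ 3 / 4 then 1 - 1 / 2 * Complex.exp (-(2 * Real.pi * Complex.I * (4 * t)))
  else 1 / 2 * Complex.exp (-(2 * Real.pi * Complex.I * (4 * t)))

/-- `γ` is a Pochhammer double loop `(1+, 0+, 1-, 0-)`: a piecewise `C¹` closed curve in
`ℂ \ {0, 1}` with base point in the interval `(0, 1)` that can be deformed continuously into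
the model loop, through closed curves in `ℂ \ {0, 1}` with base point in `(0, 1)`. -/
def IsDoubleLoop (γ : ℝ → ℂ) : Prop :=
  IsPiecewiseC1 γ ∧
    ∃ H : ℝ × ℝ → ℂ, ContinuousOn H (Set.Icc 0 1 ×ˢ Set.Icc 0 1) ∧
      (∀ t ∈ Set.Icc (0 : ℝ) 1, H (0, t) = γ t) ∧
      (∀ t ∈ Set.Icc (0 : ℝ) 1, H (1, t) = modelDoubleLoop t) ∧
      (∀ s ∈ Set.Icc (0 : ℝ) 1, ∀ t ∈ Set.Icc (0 : ℝ) 1, H (s, t) ≠ 0 ∧ H (s, t) ≠ 1) ∧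
      ∀ s ∈ Set.Icc (0 : ℝ) 1, H (s, 0) = H (s, 1) ∧ ∃ r ∈ Set.Ioo (0 : ℝ) 1, H (s, 0) = (r : ℂ)

/-- `L` is the continuous branch on `[0, 1]` of the logarithm of the curve `f` that starts at the
principal value `log (f 0)` (so with argument `0` if `f 0 > 0`). -/
def IsLogAlong (f L : ℝ → ℂ) : Prop :=
  ContinuousOn L (Set.Icc 0 1) ∧ (∀ t ∈ Set.Icc (0 : ℝ) 1, Complex.exp (L t) = f t) ∧
    L 0 = Complex.log (f 0)

open Classical in
/-- The continuous branch of the logarithm along the curve `f`, starting at `log (f 0)`. -/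
noncomputable def logAlong (f : ℝ → ℂ) : ℝ → ℂ :=
  if h : ∃ L, IsLogAlong f L then h.choose else 0

theorem isLogAlong_logAlong {f : ℝ → ℂ} (hf : ContinuousOn f (Set.Icc 0 1))
    (h0 : ∀ t ∈ Set.Icc (0 : ℝ) 1, f t ≠ 0) : IsLogAlong f (logAlong f) := by
  have hex : ∃ L, IsLogAlong f L := by
    let g : C(unitInterval, {z : ℂ // z ≠ 0}) :=
      ⟨fun t => ⟨f t, h0 t t.2⟩,
        Continuous.subtype_mk (continuousOn_iff_continuous_domRestrict.mp hf) _⟩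
    have hz : f 0 ≠ 0 := h0 0 (by simp)
    obtain ⟨Γ, hΓ, hΓ0⟩ := Complex.isCoveringMap_exp.exists_path_lifts g (Complex.log (f 0))
      (Subtype.ext (by
        change f ((0 : unitInterval) : ℝ) = Complex.exp (Complex.log (f 0))
        rw [Complex.exp_log hz]; rfl))
    refine ⟨Set.IccExtend zero_le_one Γ, ?_, fun t ht => ?_, ?_⟩
    · exact (Γ.continuous.Icc_extend' (h := zero_le_one)).continuousOn
    · rw [Set.IccExtend_of_mem _ _ ht]
      exact congrArg Subtype.val (congrFun hΓ ⟨t, ht⟩)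
    · rw [Set.IccExtend_of_mem _ _ (by simp)]
      exact hΓ0
  rw [logAlong, dif_pos hex]
  exact hex.choose_spec

/-- The integrand of the inner integral, as a function of `v ∈ [0, 1]`, at a point `u`:
`v^(d-1) (1-v)^(e-a-d-1) (1-(u⁻¹-1)vy)^(-c)`, with principal powers. -/
noncomputable def innerIntegrand (a c d e y u : ℂ) (v : ℝ) : ℂ :=
  (v : ℂ) ^ (d - 1) * (1 - v : ℂ) ^ (e - a - d - 1) * (1 - (u⁻¹ - 1) * v * y) ^ (-c)

/-- The pull-back to `[0, 1]`, by the loop `γ`, of the integrand of the outer integral (including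
`du = γ' dt`). The powers `u^(a-1)` and `(1-u)^(e-a-1)` are continued along the loop, starting with
`arg u = 0` and `arg (1 - u) = 0`; the power `(1-ux)^(-b)` is the principal one. -/
noncomputable def outerIntegrand (a b c d e x y : ℂ) (γ : ℝ → ℂ) (t : ℝ) : ℂ :=
  Complex.exp ((a - 1) * logAlong γ t)
    * Complex.exp ((e - a - 1) * logAlong (fun s => 1 - γ s) t)
    * (1 - γ t * x) ^ (-b)
    * (∫ v in (0 : ℝ)..1, innerIntegrand a c d e y (γ t) v)
    * deriv γ t

/-! The formula is an expansion of the integrand into powers of `x` and `y`, followed by the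
identity theorem. For small `x` and `y` the binomial series of `(1-ux)^(-b)` and the series of the
inner Euler integral, with coefficients `(c)_j/j! · B(d+j, e-a-d)` in powers of `(u⁻¹-1)y`, converge
uniformly on the compact curve. Since `u⁻¹-1 = (1-u)/u`, the term with indices `i, j` leaves the
integral of `u^(a+i-j-1) (1-u)^(e-a+j-1)` over the double loop. Pochhammer's formula
(`IsDoubleLoop.pochhammerIntegral_eq`) evaluates this as a constant independent of `i, j` times
`Γ(a+i-j) Γ(e-a+j) / Γ(e+i)`. The factor `Γ(e-a+j)` cancels against the beta function, and Horn's
coefficient remains (`hornH2Term_eq`).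

Pochhammer's formula needs three ingredients. The integral is invariant under deformation of the
loop (`integral_betaBranch_homotopy`). On the model loop, for exponents of positive real part,
explicit primitives on the four circles give the beta integral (`modelDoubleLoop_lift`). Two
contiguity relations, from `u + (1-u) = 1` and from the integral of an exact derivative over a
closed branch, then carry the formula to general exponents.

For analyticity in `(x, y)` the two factors of the integrand are regarded as analytic maps into the
Banach algebra of continuous functions on the parameter interval, and integration against the weight
as a bounded functional `Λ`. The contour integral is thus `Λ` of a product
(`exists_analytic_outerIntegral`). Its domain is a product of two open sets that are star-shaped
because the plane cut along `[1, ∞)` is star-shaped about `0`. Restriction to complex lines through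
the origin extends the equality with Horn's series from a neighbourhood of `0` to every point of
this domain in the convergence region (`hasSum_hornH2Term_of_eventually`), so the integral is the
required continuation. -/

open Complex Set MeasureTheory Topology Filter

/-! ### Continuous logarithms -/

theorem exp_lift_eqOn {X : Type*} [TopologicalSpace X] {s : Set X} (hs : IsPreconnected s)
    {K L : X → ℂ} (hK : ContinuousOn K s) (hL : ContinuousOn L s)
    (h : ∀ t ∈ s, exp (K t) = exp (L t)) {a : X} (ha : a ∈ s) (hKa : K a = L a) : EqOn K L s :=
  isCoveringMap_exp.eqOn_of_comp_eqOn hs hK hL (fun t ht => Subtype.ext (h t ht)) ha hKa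

theorem exists_continuous_log {f : ℝ × ℝ → ℂ} (hf : Continuous f) (h0 : ∀ p, f p ≠ 0)
    {p₀ : ℝ × ℝ} {w : ℂ} (hw : exp w = f p₀) :
    ∃ K : ℝ × ℝ → ℂ, Continuous K ∧ (∀ p, exp (K p) = f p) ∧ K p₀ = w := by
  let g : C(ℝ × ℝ, {z : ℂ // z ≠ 0}) := ⟨fun p => ⟨f p, h0 p⟩, Continuous.subtype_mk hf _⟩
  obtain ⟨K, ⟨hK0, hK⟩, -⟩ := isCoveringMap_exp.existsUnique_continuousMap_lifts g p₀ w
    (Subtype.ext hw)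
  exact ⟨K, K.continuous, fun p => congrArg Subtype.val (congrFun hK p), hK0⟩

/-! ### Local branches of `u ^ α * (1 - u) ^ β` -/

/-- The branch of `u ^ α * (1 - u) ^ β` near `u = exp k` given by the logarithms `k` of `u` and
`l` of `1 - u`. -/
noncomputable def betaBranch (α β k l u : ℂ) : ℂ :=
  exp (α * (k + log (u / exp k)) + β * (l + log ((1 - u) / exp l)))

theorem re_div_pos_of_norm_sub_lt {u w : ℂ} {ρ : ℝ} (h : ‖u - w‖ < ρ) (hw : ρ ≤ ‖w‖) :
    0 < (u / w).re := by
  have hw0 : w ≠ 0 := by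
    rintro rfl
    simp at hw
    linarith [norm_nonneg (u - 0)]
  have h1 : ‖u / w - 1‖ < 1 := by
    rw [div_sub_one hw0, norm_div, div_lt_one (norm_pos_iff.2 hw0)]
    exact h.trans_le hw
  have h2 := (abs_re_le_norm (u / w - 1)).trans_lt h1
  rw [sub_re, one_re, abs_lt] at h2
  linarith [h2.1]

theorem betaBranch_self {k l : ℂ} (h : exp k + exp l = 1) (α β : ℂ) :
    betaBranch α β k l (exp k) = exp (α * k + β * l) := by
  rw [betaBranch, ← h, add_sub_cancel_left, div_self (exp_ne_zero _), div_self (exp_ne_zero _)]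
  simp

theorem differentiableOn_betaBranch {k l : ℂ} {ρ : ℝ} (h : exp k + exp l = 1) (hk : ρ ≤ ‖exp k‖)
    (hl : ρ ≤ ‖exp l‖) (α β : ℂ) :
    DifferentiableOn ℂ (betaBranch α β k l) (Metric.ball (exp k) ρ) := by
  intro u hu
  rw [mem_ball_iff_norm] at hu
  have h1 : u / exp k ∈ slitPlane := Or.inl (re_div_pos_of_norm_sub_lt hu hk)
  have h2 : (1 - u) / exp l ∈ slitPlane := by
    refine Or.inl (re_div_pos_of_norm_sub_lt ?_ hl)
    rwa [← h, add_sub_right_comm, add_sub_cancel_right, norm_sub_rev]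
  refine DifferentiableAt.differentiableWithinAt ?_
  unfold betaBranch
  fun_prop (disch := assumption)

theorem log_div_exp_eq {k k' u : ℂ} {ρ : ℝ} (hkk : ‖k' - k‖ < 1) (hk' : ρ ≤ ‖exp k'‖)
    (hu : ‖u - exp k'‖ < ρ) : k + log (u / exp k) = k' + log (u / exp k') := by
  have him : |(k' - k).im| < 1 := (abs_im_le_norm _).trans_lt hkk
  have hre := re_div_pos_of_norm_sub_lt hu hk'
  have h1 : log (exp (k' - k)) = k' - k := by
    rw [abs_lt] at him
    exact log_exp (by linarith [Real.pi_gt_three]) (by linarith [Real.pi_gt_three])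
  have h2 : arg (exp (k' - k)) = (k' - k).im := by rw [← log_im, h1]
  have h3 := abs_arg_lt_pi_div_two_iff.2 (Or.inl hre)
  have hne : u / exp k' ≠ 0 := by
    intro h
    simp [h] at hre
  have h4 : u / exp k = exp (k' - k) * (u / exp k') := by
    rw [exp_sub]
    field_simp [exp_ne_zero]
  rw [h4, (log_mul_eq_add_log_iff (exp_ne_zero _) hne).2, h1]
  · ring
  · rw [h2]
    rw [abs_lt] at him h3
    constructor <;> linarith [Real.pi_gt_three]

theorem betaBranch_eq {k l k' l' u : ℂ} {ρ : ℝ} (h' : exp k' + exp l' = 1)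
    (hk' : ρ ≤ ‖exp k'‖) (hl' : ρ ≤ ‖exp l'‖) (hkk : ‖k' - k‖ < 1) (hll : ‖l' - l‖ < 1)
    (hu : u ∈ Metric.ball (exp k') ρ) (α β : ℂ) :
    betaBranch α β k l u = betaBranch α β k' l' u := by
  rw [mem_ball_iff_norm] at hu
  have h2 : ‖(1 - u) - exp l'‖ < ρ := by
    rwa [← h', add_sub_right_comm, add_sub_cancel_right, norm_sub_rev]
  rw [betaBranch, betaBranch, log_div_exp_eq hkk hk' hu, log_div_exp_eq hll hl' h2]

/-! ### Homotopy invariance -/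

/-- Differentiability off a countable set, with integrable derivative. -/
def IsPiecewiseDiff (γ : ℝ → ℂ) : Prop :=
  ContinuousOn γ (Icc 0 1) ∧ IntervalIntegrable (deriv γ) volume 0 1 ∧
    ∃ s : Set ℝ, s.Countable ∧ ∀ t ∈ Ioo 0 1 \ s, DifferentiableAt ℝ γ t

theorem IsPiecewiseDiff.integral_comp_deriv {γ : ℝ → ℂ} (hγ : IsPiecewiseDiff γ) {a b : ℝ}
    (hab : a ≤ b) (ha : 0 ≤ a) (hb : b ≤ 1) {U : Set ℂ} {g g' : ℂ → ℂ} (hg' : ContinuousOn g' U)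
    (hg : ∀ z ∈ U, HasDerivAt g (g' z) z) (hU : ∀ t ∈ Icc a b, γ t ∈ U) :
    ∫ t in a..b, g' (γ t) * deriv γ t = g (γ b) - g (γ a) := by
  obtain ⟨hc, hi, s, hs, hd⟩ := hγ
  have hsub : Icc a b ⊆ Icc 0 1 := Icc_subset_Icc ha hb
  have hc' := hc.mono hsub
  refine integral_eq_of_hasDerivAt_off_countable_of_le (fun t => g (γ t)) _ hab hs ?_ ?_ ?_
  · exact ContinuousOn.comp (t := U) (fun z hz => (hg z hz).continuousAt.continuousWithinAt) hc' hU
  · intro t ht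
    have h1 : DifferentiableAt ℝ γ t :=
      hd t ⟨⟨ha.trans_lt ht.1.1, ht.1.2.trans_le hb⟩, ht.2⟩
    exact (hg _ (hU t (Ioo_subset_Icc_self ht.1))).comp t h1.hasDerivAt
  · refine IntervalIntegrable.continuousOn_mul (hi.mono_set ?_) ?_
    · rwa [uIcc_of_le hab, uIcc_of_le zero_le_one]
    · rw [uIcc_of_le hab]
      exact hg'.comp hc' hU

/-- A "grid Stokes" argument: a locally additive cochain on the unit square. -/
theorem grid_sum_add {c : ℝ × ℝ → ℝ × ℝ → ℂ} {N : ℕ} (hN : 0 < N) {δ : ℝ} (hδ : (N : ℝ)⁻¹ < δ)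
    (hc : ∀ p ∈ Icc (0 : ℝ) 1 ×ˢ Icc (0 : ℝ) 1, ∀ q ∈ Icc (0 : ℝ) 1 ×ˢ Icc (0 : ℝ) 1,
      ∀ r ∈ Icc (0 : ℝ) 1 ×ˢ Icc (0 : ℝ) 1, dist p q < δ → dist q r < δ → dist p r < δ →
      c p q + c q r = c p r) {j : ℕ} (hj : j < N) {n : ℕ} (hn : n ≤ N) :
    (∑ k ∈ Finset.range n, c ((j : ℝ) / N, (k : ℝ) / N) ((j : ℝ) / N, ((k + 1 : ℕ) : ℝ) / N))
      + c ((j : ℝ) / N, (n : ℝ) / N) (((j + 1 : ℕ) : ℝ) / N, (n : ℝ) / N)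
    = c ((j : ℝ) / N, (0 : ℝ) / N) (((j + 1 : ℕ) : ℝ) / N, (0 : ℝ) / N)
      + ∑ k ∈ Finset.range n,
        c (((j + 1 : ℕ) : ℝ) / N, (k : ℝ) / N) (((j + 1 : ℕ) : ℝ) / N, ((k + 1 : ℕ) : ℝ) / N) := by
  have hN' : (0 : ℝ) < N := by exact_mod_cast hN
  have hmem : ∀ i : ℕ, i ≤ N → (i : ℝ) / N ∈ Icc (0 : ℝ) 1 := fun i hi =>
    ⟨by positivity, by rw [div_le_one hN']; exact_mod_cast hi⟩
  have hδ0 : 0 < δ := (by positivity : (0 : ℝ) < (N : ℝ)⁻¹).trans hδ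
  have hd0 : ∀ i : ℕ, dist ((i : ℝ) / N) ((i : ℝ) / N) < δ := fun i => by simpa using hδ0
  have hd1 : ∀ i : ℕ, dist ((i : ℝ) / N) (((i + 1 : ℕ) : ℝ) / N) < δ := fun i => by
    rw [Real.dist_eq, ← sub_div]
    push_cast
    rw [sub_add_cancel_left, abs_div, abs_neg, abs_one, abs_of_pos hN', one_div]
    exact hδ
  induction n with
  | zero => simp
  | succ n ih =>
    -- `h1` and `h2` are the two triangles of a grid cell; their common diagonal cancels. In the sup
    -- metric the diagonal is no longer than a side, so it is still shorter than `δ`.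
    have h1 := hc ((j : ℝ) / N, (n : ℝ) / N) ⟨hmem _ hj.le, hmem _ (by omega)⟩
      ((j : ℝ) / N, ((n + 1 : ℕ) : ℝ) / N) ⟨hmem _ hj.le, hmem _ hn⟩
      (((j + 1 : ℕ) : ℝ) / N, ((n + 1 : ℕ) : ℝ) / N) ⟨hmem _ hj, hmem _ hn⟩
      (by rw [Prod.dist_eq]; exact max_lt (hd0 _) (hd1 _))
      (by rw [Prod.dist_eq]; exact max_lt (hd1 _) (hd0 _))
      (by rw [Prod.dist_eq]; exact max_lt (hd1 _) (hd1 _))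
    have h2 := hc ((j : ℝ) / N, (n : ℝ) / N) ⟨hmem _ hj.le, hmem _ (by omega)⟩
      (((j + 1 : ℕ) : ℝ) / N, (n : ℝ) / N) ⟨hmem _ hj, hmem _ (by omega)⟩
      (((j + 1 : ℕ) : ℝ) / N, ((n + 1 : ℕ) : ℝ) / N) ⟨hmem _ hj, hmem _ hn⟩
      (by rw [Prod.dist_eq]; exact max_lt (hd1 _) (hd0 _))
      (by rw [Prod.dist_eq]; exact max_lt (hd0 _) (hd1 _))
      (by rw [Prod.dist_eq]; exact max_lt (hd1 _) (hd1 _))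
    rw [Finset.sum_range_succ, Finset.sum_range_succ, ← add_assoc, ← ih (by omega)]
    linear_combination h1 - h2

/-- The homotopy is only continuous, so its intermediate curves cannot be integrated over. They are
replaced by sums of increments of local primitives along a fine grid. These increments are additive
on small triangles, so neighbouring rows have equal sums up to the two end edges, which cancel
because both logarithms close up. Only the first and last rows are identified with actual integrals.
-/
theorem integral_betaBranch_homotopy {K L : ℝ × ℝ → ℂ}
    (hKc : ContinuousOn K (Icc 0 1 ×ˢ Icc 0 1)) (hLc : ContinuousOn L (Icc 0 1 ×ˢ Icc 0 1))
    (hKL : ∀ p ∈ Icc (0 : ℝ) 1 ×ˢ Icc (0 : ℝ) 1, exp (K p) + exp (L p) = 1)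
    (hK01 : ∀ s ∈ Icc (0 : ℝ) 1, K (s, 0) = K (s, 1))
    (hL01 : ∀ s ∈ Icc (0 : ℝ) 1, L (s, 0) = L (s, 1))
    {γ₀ γ₁ : ℝ → ℂ} (hγ₀ : IsPiecewiseDiff γ₀) (hγ₁ : IsPiecewiseDiff γ₁)
    (h₀ : ∀ t ∈ Icc (0 : ℝ) 1, exp (K (0, t)) = γ₀ t)
    (h₁ : ∀ t ∈ Icc (0 : ℝ) 1, exp (K (1, t)) = γ₁ t) (α β : ℂ) :
    ∫ t in (0 : ℝ)..1, exp (α * K (0, t) + β * L (0, t)) * deriv γ₀ t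
      = ∫ t in (0 : ℝ)..1, exp (α * K (1, t) + β * L (1, t)) * deriv γ₁ t := by
  set S : Set (ℝ × ℝ) := Icc 0 1 ×ˢ Icc 0 1 with hSdef
  have hS : IsCompact S := isCompact_Icc.prod isCompact_Icc
  have hSne : S.Nonempty := ⟨(0, 0), by simp [S]⟩
  obtain ⟨ρ, hρ, hρK, hρL⟩ : ∃ ρ : ℝ, 0 < ρ ∧ (∀ p ∈ S, ρ ≤ ‖exp (K p)‖) ∧
      ∀ p ∈ S, ρ ≤ ‖exp (L p)‖ := by
    obtain ⟨p, hp, hpm⟩ := hS.exists_isMinOn hSne (continuous_norm.comp_continuousOn hKc.cexp)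
    obtain ⟨q, hq, hqm⟩ := hS.exists_isMinOn hSne (continuous_norm.comp_continuousOn hLc.cexp)
    refine ⟨min ‖exp (K p)‖ ‖exp (L q)‖, lt_min (by simp) (by simp),
      fun r hr => (min_le_left _ _).trans (hpm hr), fun r hr => (min_le_right _ _).trans (hqm hr)⟩
  obtain ⟨δ, hδ, hδK, hδL, hδE⟩ : ∃ δ : ℝ, 0 < δ ∧
      (∀ p ∈ S, ∀ q ∈ S, dist p q < δ → ‖K p - K q‖ < 1) ∧
      (∀ p ∈ S, ∀ q ∈ S, dist p q < δ → ‖L p - L q‖ < 1) ∧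
      (∀ p ∈ S, ∀ q ∈ S, dist p q < δ → exp (K p) ∈ Metric.ball (exp (K q)) ρ) := by
    obtain ⟨δ₁, h₁, H₁⟩ := Metric.uniformContinuousOn_iff.1
      (hS.uniformContinuousOn_of_continuous hKc) 1 one_pos
    obtain ⟨δ₂, h₂, H₂⟩ := Metric.uniformContinuousOn_iff.1
      (hS.uniformContinuousOn_of_continuous hLc) 1 one_pos
    obtain ⟨δ₃, h₃, H₃⟩ := Metric.uniformContinuousOn_iff.1
      (hS.uniformContinuousOn_of_continuous hKc.cexp) ρ hρ
    refine ⟨min δ₁ (min δ₂ δ₃), lt_min h₁ (lt_min h₂ h₃), fun p hp q hq h => ?_,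
      fun p hp q hq h => ?_, fun p hp q hq h => ?_⟩
    · rw [← dist_eq_norm]
      exact H₁ p hp q hq (h.trans_le (min_le_left _ _))
    · rw [← dist_eq_norm]
      exact H₂ p hp q hq (h.trans_le ((min_le_right _ _).trans (min_le_left _ _)))
    · exact H₃ p hp q hq (h.trans_le ((min_le_right _ _).trans (min_le_right _ _)))
  -- The primitive is chosen as a function of the logarithms `k, l`, not of the grid point. Points
  -- with equal logarithms thus share one primitive, which is what makes the end edges cancel. The
  -- hypotheses sit inside the existential so that `choose` yields a total function.
  have hprim : ∀ k l : ℂ, ∃ g : ℂ → ℂ, exp k + exp l = 1 → ρ ≤ ‖exp k‖ → ρ ≤ ‖exp l‖ →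
      ∀ z ∈ Metric.ball (exp k) ρ, HasDerivAt g (betaBranch α β k l z) z := by
    intro k l
    by_cases h : exp k + exp l = 1 ∧ ρ ≤ ‖exp k‖ ∧ ρ ≤ ‖exp l‖
    · obtain ⟨g, hg⟩ := (convex_ball (exp k) ρ).exists_forall_hasDerivWithinAt
        (differentiableOn_betaBranch h.1 h.2.1 h.2.2 α β)
      exact ⟨g, fun _ _ _ z hz => (hg z hz).hasDerivAt (Metric.isOpen_ball.mem_nhds hz)⟩
    · exact ⟨0, fun h1 h2 h3 => absurd ⟨h1, h2, h3⟩ h⟩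
  choose G hG using hprim
  have hGp : ∀ p ∈ S, ∀ z ∈ Metric.ball (exp (K p)) ρ,
      HasDerivAt (G (K p) (L p)) (betaBranch α β (K p) (L p) z) z := fun p hp =>
    hG (K p) (L p) (hKL p hp) (hρK p hp) (hρL p hp)
  set c : ℝ × ℝ → ℝ × ℝ → ℂ := fun p q =>
    G (K p) (L p) (exp (K q)) - G (K p) (L p) (exp (K p)) with hcdef
  have hadd : ∀ p ∈ S, ∀ q ∈ S, ∀ r ∈ S, dist p q < δ → dist q r < δ → dist p r < δ →
      c p q + c q r = c p r := by
    intro p hp q hq r hr hpq hqr hpr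
    have hpq' : dist q p < δ := by rwa [dist_comm]
    -- Two primitives of the same branch differ by a constant on this intersection, which is convex
    -- and hence connected.
    set V := Metric.ball (exp (K p)) ρ ∩ Metric.ball (exp (K q)) ρ with hV
    have hVo : IsOpen V := Metric.isOpen_ball.inter Metric.isOpen_ball
    have hVc : IsPreconnected V := ((convex_ball _ _).inter (convex_ball _ _)).isPreconnected
    have hd : ∀ z ∈ V, HasDerivAt (fun z => G (K p) (L p) z - G (K q) (L q) z) 0 z := by
      intro z hz
      have := (hGp p hp z hz.1).sub (hGp q hq z hz.2)
      rwa [betaBranch_eq (hKL q hq) (hρK q hq) (hρL q hq) (hδK q hq p hp hpq')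
        (hδL q hq p hp hpq') hz.2, sub_self] at this
    have hqV : exp (K q) ∈ V := ⟨hδE q hq p hp hpq', Metric.mem_ball_self hρ⟩
    have hrV : exp (K r) ∈ V := ⟨hδE r hr p hp (by rwa [dist_comm]),
      hδE r hr q hq (by rwa [dist_comm])⟩
    have := hVo.is_const_of_deriv_eq_zero hVc
      (fun z hz => (hd z hz).differentiableAt.differentiableWithinAt)
      (fun z hz => (hd z hz).deriv) hqV hrV
    simp only [hcdef]
    linear_combination this
  obtain ⟨N, hN⟩ := exists_nat_gt δ⁻¹
  have hN0 : (0 : ℝ) < N := (inv_pos.2 hδ).trans hN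
  have hNn : 0 < N := by exact_mod_cast hN0
  have hNδ : (N : ℝ)⁻¹ < δ := inv_lt_of_inv_lt₀ hδ hN
  have hmem : ∀ i : ℕ, i ≤ N → (i : ℝ) / N ∈ Icc (0 : ℝ) 1 := fun i hi =>
    ⟨by positivity, by rw [div_le_one hN0]; exact_mod_cast hi⟩
  have hrow : ∀ s ∈ Icc (0 : ℝ) 1, ∀ γ : ℝ → ℂ, IsPiecewiseDiff γ →
      (∀ t ∈ Icc (0 : ℝ) 1, exp (K (s, t)) = γ t) →
      ∫ t in (0 : ℝ)..1, exp (α * K (s, t) + β * L (s, t)) * deriv γ t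
        = ∑ k ∈ Finset.range N, c (s, (k : ℝ) / N) (s, ((k + 1 : ℕ) : ℝ) / N) := by
    intro s hs γ hγ hKγ
    have hcont : ContinuousOn (fun t : ℝ => exp (α * K (s, t) + β * L (s, t))) (Icc 0 1) := by
      have hm : ContinuousOn (fun t : ℝ => (s, t)) (Icc 0 1) := by fun_prop
      have h1 := hKc.comp hm (fun t ht => ⟨hs, ht⟩)
      have h2 := hLc.comp hm (fun t ht => ⟨hs, ht⟩)
      exact ((continuousOn_const.mul h1).add (continuousOn_const.mul h2)).cexp
    have hint : IntervalIntegrable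
        (fun t : ℝ => exp (α * K (s, t) + β * L (s, t)) * deriv γ t) volume 0 1 :=
      hγ.2.1.continuousOn_mul (by rwa [uIcc_of_le zero_le_one])
    have hsplit := intervalIntegral.sum_integral_adjacent_intervals (n := N) (μ := volume)
      (f := fun t : ℝ => exp (α * K (s, t) + β * L (s, t)) * deriv γ t)
      (a := fun k : ℕ => (k : ℝ) / N) (fun k hk => hint.mono_set (by
        rw [uIcc_of_le zero_le_one, uIcc_of_le (by gcongr; simp)]
        exact Icc_subset_Icc (hmem k hk.le).1 (hmem (k + 1) hk).2))
    simp only [Nat.cast_zero, zero_div, div_self hN0.ne'] at hsplit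
    rw [← hsplit]
    refine Finset.sum_congr rfl fun k hk => ?_
    rw [Finset.mem_range] at hk
    have hle : (k : ℝ) / N ≤ ((k + 1 : ℕ) : ℝ) / N := by gcongr; simp
    set p : ℝ × ℝ := (s, (k : ℝ) / N) with hpdef
    have hp : p ∈ S := ⟨hs, hmem k hk.le⟩
    have hnear : ∀ t ∈ Icc ((k : ℝ) / N) (((k + 1 : ℕ) : ℝ) / N),
        (s, t) ∈ S ∧ dist (s, t) p < δ := by
      intro t ht
      refine ⟨⟨hs, (hmem k hk.le).1.trans ht.1, ht.2.trans (hmem (k + 1) hk).2⟩, ?_⟩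
      rw [Prod.dist_eq]
      refine max_lt (by simpa [hpdef] using hδ) ?_
      rw [hpdef, Real.dist_eq, abs_of_nonneg (sub_nonneg.2 ht.1)]
      refine lt_of_le_of_lt ?_ hNδ
      have := ht.2
      push_cast at this
      rw [add_div, one_div] at this
      linarith
    have key := hγ.integral_comp_deriv hle (hmem k hk.le).1 (hmem (k + 1) hk).2
      (differentiableOn_betaBranch (hKL p hp) (hρK p hp) (hρL p hp) α β).continuousOn (hGp p hp)
      (fun t ht => by
        rw [← hKγ t (hnear t ht).1.2]
        exact hδE _ (hnear t ht).1 p hp (hnear t ht).2)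
    have hk1 := hKγ _ (hmem k hk.le)
    have hk2 := hKγ _ (hmem (k + 1) hk)
    simp only [hcdef]
    rw [hk1, hk2, ← key]
    refine intervalIntegral.integral_congr fun t ht => ?_
    rw [uIcc_of_le hle] at ht
    obtain ⟨htS, htd⟩ := hnear t ht
    rw [← betaBranch_self (hKL _ htS), ← hKγ t htS.2]
    congr 1
    exact (betaBranch_eq (hKL _ htS) (hρK _ htS) (hρL _ htS) (hδK _ htS p hp htd)
      (hδL _ htS p hp htd) (Metric.mem_ball_self hρ) α β).symm
  have hstep : ∀ j : ℕ, j ≤ N →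
      ∑ k ∈ Finset.range N, c ((0 : ℝ), (k : ℝ) / N) (0, ((k + 1 : ℕ) : ℝ) / N)
      = ∑ k ∈ Finset.range N, c ((j : ℝ) / N, (k : ℝ) / N) ((j : ℝ) / N, ((k + 1 : ℕ) : ℝ) / N) := by
    intro j
    induction j with
    | zero => simp
    | succ j ih =>
      intro hj
      rw [ih (by omega)]
      have h := grid_sum_add hNn hNδ hadd (j := j) (by omega) (n := N) le_rfl
      rw [div_self hN0.ne', zero_div] at h
      -- The edges at `t = 0` and `t = 1` have the same logarithms, hence the same increments; the
      -- base point is free to move during the deformation.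
      have h0 : c ((j : ℝ) / N, (0 : ℝ)) (((j + 1 : ℕ) : ℝ) / N, (0 : ℝ))
          = c ((j : ℝ) / N, (1 : ℝ)) (((j + 1 : ℕ) : ℝ) / N, (1 : ℝ)) := by
        simp only [hcdef]
        rw [hK01 _ (hmem j (by omega)), hL01 _ (hmem j (by omega)), hK01 _ (hmem (j + 1) hj)]
      linear_combination h + h0
  rw [hrow 0 (by simp) γ₀ hγ₀ h₀, hrow 1 (by simp) γ₁ hγ₁ h₁]
  have := hstep N le_rfl
  rwa [div_self hN0.ne'] at this

/-! ### Euler's integral -/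

/-- The plane cut along `[1, ∞)`. -/
def cutPlane : Set ℂ := {z | ∀ r : ℝ, 1 ≤ r → z ≠ r}

theorem cutPlane_eq : cutPlane = (ofReal '' Ici 1)ᶜ := by
  ext z
  simp only [cutPlane, mem_ofPred_eq, mem_compl_iff, mem_image, mem_Ici, not_exists, not_and]
  exact ⟨fun h r hr e => h r hr e.symm, fun h r hr e => h r hr e.symm⟩

theorem isOpen_cutPlane : IsOpen cutPlane := by
  rw [cutPlane_eq, isOpen_compl_iff]
  exact Complex.isometry_ofReal.isClosedEmbedding.isClosedMap _ isClosed_Ici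

/-- Star-shapedness of the cut plane about `0`. It keeps `1 - v z` off the branch cut in Euler's
integral, and later makes the domain of continuation star-shaped. -/
theorem mul_mem_cutPlane {z : ℂ} (hz : z ∈ cutPlane) {v : ℝ} (hv : v ∈ Icc (0 : ℝ) 1) :
    v * z ∈ cutPlane := by
  intro r hr h
  rcases hv.1.eq_or_lt with rfl | hv0
  · have h2 : (0 : ℝ) = r := by simpa using congrArg re h
    linarith
  · refine hz (r / v) (by rw [le_div_iff₀ hv0]; linarith [hv.2]) ?_
    have hv' : (v : ℂ) ≠ 0 := by exact_mod_cast hv0.ne'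
    push_cast
    rw [← h, mul_div_cancel_left₀ _ hv']

theorem one_sub_mem_slitPlane {z : ℂ} (hz : z ∈ cutPlane) : 1 - z ∈ slitPlane := by
  rw [mem_slitPlane_iff]
  by_contra! h
  obtain ⟨h1, h2⟩ := h
  rw [sub_re, one_re] at h1
  rw [sub_im, one_im, zero_sub, neg_eq_zero] at h2
  exact hz z.re (by linarith) (Complex.ext (by simp) (by simp [h2]))

theorem ball_subset_cutPlane : Metric.ball (0 : ℂ) 1 ⊆ cutPlane := by
  intro z hz r hr h
  rw [mem_ball_zero_iff, h, norm_real, Real.norm_eq_abs] at hz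
  linarith [le_abs_self r]

/-- Euler's integral `∫₀¹ v ^ (d - 1) (1 - v) ^ (s - 1) (1 - v z) ^ (-c) dv`. -/
noncomputable def eulerIntegral (d s c z : ℂ) : ℂ :=
  ∫ v in (0 : ℝ)..1, ((v : ℂ) ^ (d - 1) * (1 - (v : ℂ)) ^ (s - 1)) * (1 - v * z) ^ (-c)

theorem continuousOn_one_sub_mul_cpow (c : ℂ) :
    ContinuousOn (fun p : ℝ × ℂ => (1 - (p.1 : ℂ) * p.2) ^ c) (Icc 0 1 ×ˢ cutPlane) := by
  refine ContinuousOn.cpow (by fun_prop) continuousOn_const fun p hp => ?_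
  exact one_sub_mem_slitPlane (mul_mem_cutPlane hp.2 hp.1)

theorem continuousOn_one_sub_mul_cpow_left (c : ℂ) {z : ℂ} (hz : z ∈ cutPlane) :
    ContinuousOn (fun v : ℝ => (1 - (v : ℂ) * z) ^ c) (Icc 0 1) :=
  (continuousOn_one_sub_mul_cpow c).comp (f := fun v : ℝ => (v, z)) (by fun_prop)
    fun _ hv => ⟨hv, hz⟩

theorem intervalIntegrable_eulerIntegral {d s : ℂ} (hd : 0 < d.re) (hs : 0 < s.re) (c : ℂ) {z : ℂ}
    (hz : z ∈ cutPlane) : IntervalIntegrable (fun v : ℝ =>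
      ((v : ℂ) ^ (d - 1) * (1 - (v : ℂ)) ^ (s - 1)) * (1 - v * z) ^ (-c)) volume 0 1 := by
  refine (betaIntegral_convergent hd hs).mul_continuousOn ?_
  rw [uIcc_of_le zero_le_one]
  exact continuousOn_one_sub_mul_cpow_left _ hz

theorem hasDerivAt_one_sub_mul_cpow (c : ℂ) {v : ℝ} (hv : v ∈ Icc (0 : ℝ) 1) {z : ℂ}
    (hz : z ∈ cutPlane) :
    HasDerivAt (fun z : ℂ => (1 - (v : ℂ) * z) ^ (-c))
      (c * (v * (1 - (v : ℂ) * z) ^ (-c - 1))) z := by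
  have h1 : HasDerivAt (fun z : ℂ => 1 - (v : ℂ) * z) (-(v : ℂ)) z := by
    simpa using ((hasDerivAt_id z).const_mul (v : ℂ)).const_sub 1
  convert! h1.cpow_const (c := -c) (one_sub_mem_slitPlane (mul_mem_cutPlane hz hv)) using 1
  ring

theorem hasDerivAt_eulerIntegral {d s : ℂ} (hd : 0 < d.re) (hs : 0 < s.re) (c : ℂ) {z : ℂ}
    (hz : z ∈ cutPlane) :
    HasDerivAt (eulerIntegral d s c) (∫ v in (0 : ℝ)..1, ((v : ℂ) ^ (d - 1) *
      (1 - (v : ℂ)) ^ (s - 1)) * (c * (v * (1 - (v : ℂ) * z) ^ (-c - 1)))) z := by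
  obtain ⟨R, hR, hRD⟩ := Metric.nhds_basis_closedBall.mem_iff.1 (isOpen_cutPlane.mem_nhds hz)
  have hcont : ContinuousOn (fun p : ℝ × ℂ => c * ((p.1 : ℂ) * (1 - (p.1 : ℂ) * p.2) ^ (-c - 1)))
      (Icc 0 1 ×ˢ cutPlane) := by
    refine continuousOn_const.mul (ContinuousOn.mul (by fun_prop) ?_)
    exact continuousOn_one_sub_mul_cpow _
  obtain ⟨M, hM⟩ := (isCompact_Icc.prod (isCompact_closedBall z R)).exists_bound_of_continuousOn
    (hcont.mono (prod_mono_right hRD))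
  have huI : ∀ t ∈ uIoc (0 : ℝ) 1, t ∈ Icc (0 : ℝ) 1 := fun t ht => by
    rw [uIoc_of_le zero_le_one] at ht
    exact Ioc_subset_Icc_self ht
  have hint : ∀ w ∈ cutPlane, IntervalIntegrable (fun v : ℝ => ((v : ℂ) ^ (d - 1) *
      (1 - (v : ℂ)) ^ (s - 1)) * (c * (v * (1 - (v : ℂ) * w) ^ (-c - 1)))) volume 0 1 := by
    intro w hw
    refine (betaIntegral_convergent hd hs).mul_continuousOn ?_
    rw [uIcc_of_le zero_le_one]
    exact hcont.comp (f := fun v : ℝ => (v, w)) (by fun_prop) fun _ hv => ⟨hv, hw⟩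
  refine (intervalIntegral.hasDerivAt_integral_of_dominated_loc_of_deriv_le
    (F := fun w (v : ℝ) => ((v : ℂ) ^ (d - 1) * (1 - (v : ℂ)) ^ (s - 1)) * (1 - v * w) ^ (-c))
    (F' := fun w (v : ℝ) => ((v : ℂ) ^ (d - 1) *
      (1 - (v : ℂ)) ^ (s - 1)) * (c * (v * (1 - (v : ℂ) * w) ^ (-c - 1))))
    (bound := fun v : ℝ => ‖(v : ℂ) ^ (d - 1) * (1 - (v : ℂ)) ^ (s - 1)‖ * M)
    (Metric.closedBall_mem_nhds z hR) ?_ (intervalIntegrable_eulerIntegral hd hs c hz)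
    (hint z hz).def'.aestronglyMeasurable ?_
    ((betaIntegral_convergent hd hs).norm.mul_const M) ?_).2
  · filter_upwards [isOpen_cutPlane.mem_nhds hz] with w hw
    exact (intervalIntegrable_eulerIntegral hd hs c hw).def'.aestronglyMeasurable
  · refine Eventually.of_forall fun t ht w hw => ?_
    rw [norm_mul]
    gcongr
    exact hM (t, w) ⟨huI t ht, hw⟩
  · refine Eventually.of_forall fun t ht w hw => ?_
    exact (hasDerivAt_one_sub_mul_cpow c (huI t ht) (hRD hw)).const_mul _

theorem differentiableOn_eulerIntegral {d s : ℂ} (hd : 0 < d.re) (hs : 0 < s.re) (c : ℂ) :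
    DifferentiableOn ℂ (eulerIntegral d s c) cutPlane := fun _ hz =>
  (hasDerivAt_eulerIntegral hd hs c hz).differentiableAt.differentiableWithinAt

/-- The function `β⁻¹ ₂F₁(1 - α, β; β + 1; z)`, written as an Euler integral. -/
noncomputable def incompleteBeta (α β z : ℂ) : ℂ := eulerIntegral β 1 (1 - α) z

/-- Integrating the derivative of `v ^ β * (1 - v z) ^ (α - 1)` over `[0, 1]` gives this
differential equation. It says that `z ^ β` times the function is a primitive of `z ^ (β - 1) (1 -
z) ^ (α - 1)`. -/
theorem hasDerivAt_incompleteBeta (α : ℂ) {β : ℂ} (hβ : 0 < β.re) {z : ℂ} (hz : z ∈ cutPlane) :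
    ∃ h', HasDerivAt (incompleteBeta α β) h' z ∧
      β * incompleteBeta α β z + z * h' = (1 - z) ^ (α - 1) := by
  refine ⟨_, hasDerivAt_eulerIntegral hβ (by simp) (1 - α) hz, ?_⟩
  have hi1 := intervalIntegrable_eulerIntegral hβ (s := 1) (by simp) (1 - α) hz
  have hi2 : IntervalIntegrable (fun v : ℝ => ((v : ℂ) ^ (β - 1) *
      (1 - (v : ℂ)) ^ ((1 : ℂ) - 1)) * ((1 - α) * (v * (1 - (v : ℂ) * z) ^ (-(1 - α) - 1))))
      volume 0 1 := by
    refine (betaIntegral_convergent hβ (by simp)).mul_continuousOn ?_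
    rw [uIcc_of_le zero_le_one]
    exact continuousOn_const.mul (ContinuousOn.mul (by fun_prop)
      (continuousOn_one_sub_mul_cpow_left _ hz))
  have hβ0 : β ≠ 0 := fun h => by simp [h] at hβ
  have hFTC := intervalIntegral.integral_eq_sub_of_hasDerivAt_of_le zero_le_one
    (f := fun v : ℝ => (v : ℂ) ^ β * (1 - v * z) ^ (α - 1))
    (f' := fun v : ℝ => β * (((v : ℂ) ^ (β - 1) * (1 - (v : ℂ)) ^ ((1 : ℂ) - 1)) *
        (1 - v * z) ^ (-(1 - α))) +
      z * (((v : ℂ) ^ (β - 1) * (1 - (v : ℂ)) ^ ((1 : ℂ) - 1)) *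
        ((1 - α) * (v * (1 - (v : ℂ) * z) ^ (-(1 - α) - 1))))) ?_ ?_
    ((hi1.const_mul β).add (hi2.const_mul z))
  · rw [intervalIntegral.integral_add (hi1.const_mul β) (hi2.const_mul z),
      intervalIntegral.integral_const_mul, intervalIntegral.integral_const_mul] at hFTC
    rw [incompleteBeta, eulerIntegral, hFTC]
    simp [hβ0]
  · refine ContinuousOn.mul ?_ (continuousOn_one_sub_mul_cpow_left _ hz)
    exact (continuous_ofReal_cpow_const hβ).continuousOn
  · intro v hv
    have hv0 : (v : ℂ) ≠ 0 := by exact_mod_cast hv.1.ne'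
    have h1 : HasDerivAt (fun v : ℝ => (v : ℂ) ^ β) (β * (v : ℂ) ^ (β - 1)) v := by
      have := (hasDerivAt_id (v : ℂ)).cpow_const (c := β)
        (Or.inl (by simpa using hv.1))
      simpa using this.comp_ofReal
    have h2 : HasDerivAt (fun w : ℂ => (1 - w * z) ^ (α - 1))
        ((α - 1) * (1 - v * z) ^ (α - 1 - 1) * (-z)) v := by
      have h3 : HasDerivAt (fun w : ℂ => 1 - w * z) (-z) v := by
        simpa using ((hasDerivAt_id (v : ℂ)).mul_const z).const_sub 1
      exact h3.cpow_const (one_sub_mem_slitPlane (mul_mem_cutPlane hz (Ioo_subset_Icc_self hv)))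
    convert! h1.mul h2.comp_ofReal using 1
    have h4 : (v : ℂ) ^ β = v ^ (β - 1) * v := by
      rw [cpow_sub _ _ hv0, cpow_one, div_mul_cancel₀ _ hv0]
    rw [h4, sub_self, cpow_zero, neg_sub]
    ring

theorem half_cpow_mul_incompleteBeta (α β : ℂ) :
    (1 / 2 : ℂ) ^ β * incompleteBeta α β (1 / 2)
      = ∫ v in (0 : ℝ)..(1 / 2), (v : ℂ) ^ (β - 1) * (1 - (v : ℂ)) ^ (α - 1) := by
  have h := intervalIntegral.integral_comp_mul_left (a := 0) (b := 1) (c := 1 / 2)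
    (fun v : ℝ => (v : ℂ) ^ (β - 1) * (1 - (v : ℂ)) ^ (α - 1)) (by norm_num)
  rw [mul_zero, mul_one] at h
  have h' : (∫ v in (0 : ℝ)..(1 / 2), (v : ℂ) ^ (β - 1) * (1 - (v : ℂ)) ^ (α - 1))
      = (1 / 2 : ℂ) * ∫ v in (0 : ℝ)..1, ((1 / 2 * v : ℝ) : ℂ) ^ (β - 1) *
        (1 - ((1 / 2 * v : ℝ) : ℂ)) ^ (α - 1) := by
    rw [h, real_smul]
    push_cast
    ring
  rw [h', incompleteBeta, eulerIntegral, ← intervalIntegral.integral_const_mul,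
    ← intervalIntegral.integral_const_mul]
  refine intervalIntegral.integral_congr fun v hv => ?_
  rw [uIcc_of_le zero_le_one] at hv
  have h1 : ((1 / 2 * v : ℝ) : ℂ) ^ (β - 1) = (1 / 2 : ℂ) ^ (β - 1) * (v : ℂ) ^ (β - 1) := by
    have := mul_cpow_ofReal_nonneg (a := 1 / 2) (by norm_num) hv.1 (β - 1)
    push_cast at this ⊢
    exact this
  have h2 : (1 / 2 : ℂ) ^ β = (1 / 2 : ℂ) ^ (β - 1) * (1 / 2) := by
    rw [cpow_sub _ _ (by norm_num), cpow_one, div_mul_cancel₀ _ (by norm_num)]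
  rw [h1, h2, sub_self, cpow_zero, neg_sub]
  push_cast
  ring_nf

/-- The substitution `v ↦ 1 - v` turns the second half-integral into the one over `[1/2, 1]`, so the
beta integral is split at the point where the two circles of the model loop touch. -/
theorem half_cpow_mul_incompleteBeta_add {α β : ℂ} (hα : 0 < α.re) (hβ : 0 < β.re) :
    (1 / 2 : ℂ) ^ α * incompleteBeta β α (1 / 2) + (1 / 2 : ℂ) ^ β * incompleteBeta α β (1 / 2)
      = betaIntegral α β := by
  rw [half_cpow_mul_incompleteBeta, half_cpow_mul_incompleteBeta]
  have h := intervalIntegral.integral_comp_sub_left (a := 0) (b := 1 / 2)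
    (fun v : ℝ => (v : ℂ) ^ (α - 1) * (1 - (v : ℂ)) ^ (β - 1)) 1
  have h' : (∫ v in (0 : ℝ)..(1 / 2), (v : ℂ) ^ (β - 1) * (1 - (v : ℂ)) ^ (α - 1))
      = ∫ v in (1 / 2 : ℝ)..1, (v : ℂ) ^ (α - 1) * (1 - (v : ℂ)) ^ (β - 1) := by
    norm_num at h
    rw [← h]
    refine intervalIntegral.integral_congr fun v _ => ?_
    ring
  have hint := betaIntegral_convergent hα hβ
  rw [h', betaIntegral]
  refine intervalIntegral.integral_add_adjacent_intervals (hint.mono_set ?_) (hint.mono_set ?_)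
  · rw [uIcc_of_le (by norm_num), uIcc_of_le zero_le_one]
    exact Icc_subset_Icc le_rfl (by norm_num)
  · rw [uIcc_of_le (by norm_num), uIcc_of_le zero_le_one]
    exact Icc_subset_Icc (by norm_num) le_rfl

/-! ### Piecewise smooth curves and logarithms along them -/

/-- By continuity, `L` stays within distance `1` of `L t` near `t`, so there it equals `L t` plus
the principal logarithm of `f s / f t`. -/
theorem hasDerivAt_of_exp_eq {L f : ℝ → ℂ} {t : ℝ} {f' : ℂ} (hL : ContinuousAt L t)
    (hf : HasDerivAt f f' t) (h : ∀ᶠ s in 𝓝 t, exp (L s) = f s) : HasDerivAt L (f' / f t) t := by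
  have ht : exp (L t) = f t := h.self_of_nhds
  have ht0 : f t ≠ 0 := ht ▸ exp_ne_zero _
  have h1 : HasDerivAt (fun s => L t + log (f s / f t)) (f' / f t) t := by
    have h2 : HasDerivAt (fun s => f s / f t) (f' / f t) t := hf.div_const _
    have h3 := (h2.clog_real (by simp [ht0])).const_add (L t)
    simpa [ht0] using h3
  refine h1.congr_of_eventuallyEq ?_
  filter_upwards [h, Metric.continuousAt_iff'.1 hL 1 one_pos] with s hs hd
  rw [dist_eq_norm] at hd
  have him := abs_lt.1 ((abs_im_le_norm _).trans_lt hd)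
  rw [← hs, ← ht, ← exp_sub, log_exp (by linarith [Real.pi_gt_three]) (by linarith [Real.pi_gt_three]),
    add_sub_cancel]

theorem IsPiecewiseC1.isPiecewiseDiff {γ : ℝ → ℂ} (hγ : IsPiecewiseC1 γ) : IsPiecewiseDiff γ := by
  obtain ⟨hc, n, τ, hτ, h0, h1, hd⟩ := hγ
  refine ⟨hc, ?_, range τ, countable_range τ, ?_⟩
  · rw [← h0, ← h1]
    refine IntervalIntegrable.trans_iterate fun k hk => ?_
    rcases (hτ k.le_succ).eq_or_lt with he | hlt
    · rw [← he]
    · have hcd := (hd k hk).continuousOn_derivWithin (uniqueDiffOn_Icc hlt) le_rfl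
      rw [← uIcc_of_le hlt.le] at hcd
      refine hcd.intervalIntegrable.congr_uIoo fun t ht => ?_
      rw [uIoo_of_le hlt.le] at ht
      rw [uIcc_of_le hlt.le]
      exact derivWithin_of_mem_nhds (Icc_mem_nhds ht.1 ht.2)
  · rintro t ⟨ht, hts⟩
    -- The least such index is positive, and since `t` is not a break point it lies in the interior
    -- of the piece ending there.
    have hex : ∃ i, t < τ i := ⟨n, h1 ▸ ht.2⟩
    classical
    have hk := Nat.find_spec hex
    have hk0 : Nat.find hex ≠ 0 := by
      intro h
      rw [h, h0] at hk
      exact absurd hk (not_lt.2 ht.1.le)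
    obtain ⟨i, hi⟩ := Nat.exists_eq_succ_of_ne_zero hk0
    have hi1 : ¬ t < τ i := Nat.find_min hex (by omega)
    have hi2 : τ i < t := lt_of_le_of_ne (not_lt.1 hi1) fun h => hts ⟨i, h⟩
    have hin : i < n := by
      by_contra! h
      have := hτ h
      linarith [ht.2]
    rw [hi] at hk
    exact ((hd i hin).contDiffAt (Icc_mem_nhds hi2 hk)).differentiableAt one_ne_zero

theorem IsPiecewiseDiff.one_sub {γ : ℝ → ℂ} (hγ : IsPiecewiseDiff γ) :
    IsPiecewiseDiff fun t => 1 - γ t := by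
  obtain ⟨hc, hi, s, hs, hd⟩ := hγ
  refine ⟨continuousOn_const.sub hc, ?_, s, hs, fun t ht => (hd t ht).const_sub 1⟩
  have : deriv (fun t => 1 - γ t) = fun t => -deriv γ t := by
    ext t
    exact deriv_const_sub 1
  rw [this]
  exact hi.neg

theorem IsPiecewiseDiff.intervalIntegrable_mul_deriv {γ : ℝ → ℂ} (hγ : IsPiecewiseDiff γ) {p q : ℝ}
    (hp : 0 ≤ p) (hpq : p ≤ q) (hq : q ≤ 1) {f : ℝ → ℂ} (hf : ContinuousOn f (Icc p q)) :
    IntervalIntegrable (fun t => f t * deriv γ t) volume p q := by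
  refine (hγ.2.1.mono_set ?_).continuousOn_mul (by rwa [uIcc_of_le hpq])
  rw [uIcc_of_le hpq, uIcc_of_le zero_le_one]
  exact Icc_subset_Icc hp hq

/-! ### The integrals along the arcs of the model loop -/

/-- The primitive is `-(1-u)^β` times `incompleteBeta α β (1-u)`, the sign coming from `d(1-u) =
-du`. The second factor is single-valued near `u = 1`, so all monodromy sits in `exp (β * L)`. The
integer `n` records the branch of `log u`, which is constant along the arc. -/
theorem integral_arc_near_one {γ K L : ℝ → ℂ} (hγ : IsPiecewiseDiff γ) {p q : ℝ} (hp : 0 ≤ p)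
    (hpq : p ≤ q) (hq : q ≤ 1) (hL : ContinuousOn L (Icc p q)) (hK : ContinuousOn K (Icc p q))
    (hLγ : ∀ t ∈ Icc p q, exp (L t) = 1 - γ t) (hcut : ∀ t ∈ Icc p q, 1 - γ t ∈ cutPlane) {n : ℤ}
    (hKγ : ∀ t ∈ Icc p q, K t = log (γ t) + n * (2 * Real.pi * I)) (α : ℂ) {β : ℂ}
    (hβ : 0 < β.re) :
    ∫ t in p..q, exp ((α - 1) * K t + (β - 1) * L t) * deriv γ t
      = exp (α * (n * (2 * Real.pi * I))) * (exp (β * L p) * incompleteBeta α β (1 - γ p)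
        - exp (β * L q) * incompleteBeta α β (1 - γ q)) := by
  obtain ⟨hc, -, s, hs, hd⟩ := id hγ
  have hsub : Icc p q ⊆ Icc 0 1 := Icc_subset_Icc hp hq
  have hmain := integral_eq_of_hasDerivAt_off_countable_of_le
    (fun t => -(exp (α * (n * (2 * Real.pi * I)))) *
      (exp (β * L t) * incompleteBeta α β (1 - γ t)))
    (fun t => exp ((α - 1) * K t + (β - 1) * L t) * deriv γ t) hpq hs ?_ ?_
    (hγ.intervalIntegrable_mul_deriv hp hpq hq
      ((continuousOn_const.mul hK).add (continuousOn_const.mul hL)).cexp)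
  · rw [hmain]
    ring
  · refine continuousOn_const.mul ((continuousOn_const.mul hL).cexp.mul ?_)
    exact (differentiableOn_eulerIntegral hβ (by simp) _).continuousOn.comp
      (continuousOn_const.sub (hc.mono hsub)) hcut
  · rintro t ⟨ht, hts⟩
    have htI := Ioo_subset_Icc_self ht
    have hγ' : HasDerivAt γ (deriv γ t) t :=
      (hd t ⟨⟨hp.trans_lt ht.1, ht.2.trans_le hq⟩, hts⟩).hasDerivAt
    have hL' : HasDerivAt L (-deriv γ t / (1 - γ t)) t :=
      hasDerivAt_of_exp_eq (f := fun t => 1 - γ t) (hL.continuousAt (Icc_mem_nhds ht.1 ht.2))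
        (hγ'.const_sub 1) (by
          filter_upwards [Icc_mem_nhds ht.1 ht.2] with u hu using hLγ u hu)
    obtain ⟨h', hh', hode⟩ := hasDerivAt_incompleteBeta α hβ (hcut t htI)
    have hh := HasDerivAt.comp t hh' (hγ'.const_sub 1)
    have hne : 1 - γ t ≠ 0 := hLγ t htI ▸ exp_ne_zero _
    have hγ0 : γ t ≠ 0 := fun h => hcut t htI 1 le_rfl (by simp [h])
    convert! (((hL'.const_mul β).cexp.mul hh).const_mul
      (-(exp (α * (n * (2 * Real.pi * I)))))) using 1
    rw [sub_sub_cancel, cpow_def_of_ne_zero hγ0] at hode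
    -- The left side carries the phase of `(α - 1) n`, the right side that of `α n`; they differ by
    -- an integer multiple of `2πi`, whence the witness `-n`.
    have e1 : exp ((α - 1) * K t + (β - 1) * L t) = exp (log (γ t) * (α - 1)) *
        exp (α * (n * (2 * Real.pi * I))) * (exp (β * L t) / (1 - γ t)) := by
      rw [← hLγ t htI, ← exp_sub, ← exp_add, ← exp_add, hKγ t htI, exp_eq_exp_iff_exists_int]
      exact ⟨-n, by push_cast; ring⟩
    rw [e1, ← hode]
    simp only [Function.comp]
    field_simp
    ring

/-- The circle of radius `1 / 2` around `1`. -/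
theorem integral_circle_arc {γ K L : ℝ → ℂ} (hγ : IsPiecewiseDiff γ) {j : ℕ} {p q : ℝ} {σ m n : ℤ}
    (hpj : p = j / 4) (hqj : q = p + 1 / 4) (hq : q ≤ 1)
    (hL : ContinuousOn L (Icc 0 1)) (hK : ContinuousOn K (Icc 0 1))
    (hLγ : ∀ t ∈ Icc (0 : ℝ) 1, exp (L t) = 1 - γ t) (hKγ : ∀ t ∈ Icc (0 : ℝ) 1, exp (K t) = γ t)
    (hcirc : ∀ t ∈ Icc p q, 1 - γ t = 1 / 2 * exp (σ * (2 * Real.pi * I * (4 * t))))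
    (hLp : L p = log (1 / 2) + m * (2 * Real.pi * I))
    (hKp : K p = log (1 / 2) + n * (2 * Real.pi * I)) :
    L q = log (1 / 2) + (m + σ : ℤ) * (2 * Real.pi * I) ∧
    K q = log (1 / 2) + n * (2 * Real.pi * I) ∧
    ∀ α β : ℂ, 0 < β.re →
      ∫ t in p..q, exp ((α - 1) * K t + (β - 1) * L t) * deriv γ t
        = exp (α * (n * (2 * Real.pi * I))) * (exp (β * (m * (2 * Real.pi * I))) -
          exp (β * ((m + σ : ℤ) * (2 * Real.pi * I)))) *
          ((1 / 2 : ℂ) ^ β * incompleteBeta α β (1 / 2)) := by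
  have hp : 0 ≤ p := by rw [hpj]; positivity
  have hpq : p ≤ q := by linarith
  have hsub : Icc p q ⊆ Icc 0 1 := Icc_subset_Icc hp hq
  have hpI : p ∈ Icc p q := ⟨le_rfl, hpq⟩
  have hqI : q ∈ Icc p q := ⟨hpq, le_rfl⟩
  -- Here `4p = j` is an integer, so every arc starts at the common point `1/2`.
  have hexp : exp (σ * (2 * Real.pi * I * (4 * p))) = 1 := by
    rw [← exp_int_mul_two_pi_mul_I (σ * j), hpj]
    congr 1
    push_cast
    ring
  have hnorm : ∀ t ∈ Icc p q, ‖1 - γ t‖ = 1 / 2 := by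
    intro t ht
    rw [hcirc t ht, show (σ : ℂ) * (2 * Real.pi * I * (4 * t)) =
      ((σ * (2 * Real.pi * (4 * t)) : ℝ) : ℂ) * I by push_cast; ring, norm_mul,
      norm_exp_ofReal_mul_I]
    simp
  have hcut : ∀ t ∈ Icc p q, 1 - γ t ∈ cutPlane := fun t ht =>
    ball_subset_cutPlane (by rw [mem_ball_zero_iff, hnorm t ht]; norm_num)
  have hslit : ∀ t ∈ Icc p q, γ t ∈ slitPlane := fun t ht => by
    simpa using one_sub_mem_slitPlane (hcut t ht)
  have hγp : γ p = 1 / 2 := by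
    have := hcirc p hpI
    rw [hexp] at this
    linear_combination -this
  have hhalf : exp (log (1 / 2)) = 1 / 2 := exp_log (by norm_num)
  have hLt : EqOn L (fun t => L p + σ * (2 * Real.pi * I * (4 * (t - p)))) (Icc p q) := by
    refine exp_lift_eqOn isPreconnected_Icc (hL.mono hsub) (by fun_prop) (fun t ht => ?_) hpI
      (by simp)
    rw [hLγ t (hsub ht), hcirc t ht, mul_sub, mul_sub, mul_sub, exp_add, exp_sub, hexp, hLp,
      exp_add, exp_int_mul_two_pi_mul_I, hhalf]
    simp
  have hKt : EqOn K (fun t => log (γ t) + n * (2 * Real.pi * I)) (Icc p q) := by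
    refine exp_lift_eqOn isPreconnected_Icc (hK.mono hsub)
      (((hγ.1.mono hsub).clog hslit).add continuousOn_const) (fun t ht => ?_) hpI
      (by rw [hKp, hγp])
    rw [hKγ t (hsub ht), exp_add, exp_int_mul_two_pi_mul_I, exp_log, mul_one]
    exact slitPlane_ne_zero (hslit t ht)
  have hLq : L q = log (1 / 2) + (m + σ : ℤ) * (2 * Real.pi * I) := by
    rw [hLt hqI, hLp, hqj]
    push_cast
    ring
  have hγq : γ q = 1 / 2 := by
    have := hLγ q (hsub hqI)
    rw [hLq, exp_add, exp_int_mul_two_pi_mul_I, hhalf] at this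
    linear_combination this
  refine ⟨hLq, by simp only [hKt hqI, hγq], fun α β hβ => ?_⟩
  rw [integral_arc_near_one hγ hp hpq hq (hL.mono hsub) (hK.mono hsub)
    (fun t ht => hLγ t (hsub ht)) hcut hKt α hβ, hγp, hγq, hLp, hLq, mul_add, mul_add, exp_add,
    exp_add, cpow_def_of_ne_zero (by norm_num), mul_comm (log _)]
  norm_num
  ring

/-- The symmetry `u ↦ 1 - u` exchanges the two circles, the two logarithms and the two exponents,
and reverses the sign of `du`. -/
theorem integral_circle_arc' {γ K L : ℝ → ℂ} (hγ : IsPiecewiseDiff γ) {j : ℕ} {p q : ℝ} {σ m n : ℤ}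
    (hpj : p = j / 4) (hqj : q = p + 1 / 4) (hq : q ≤ 1)
    (hL : ContinuousOn L (Icc 0 1)) (hK : ContinuousOn K (Icc 0 1))
    (hLγ : ∀ t ∈ Icc (0 : ℝ) 1, exp (L t) = 1 - γ t) (hKγ : ∀ t ∈ Icc (0 : ℝ) 1, exp (K t) = γ t)
    (hcirc : ∀ t ∈ Icc p q, γ t = 1 / 2 * exp (σ * (2 * Real.pi * I * (4 * t))))
    (hLp : L p = log (1 / 2) + m * (2 * Real.pi * I))
    (hKp : K p = log (1 / 2) + n * (2 * Real.pi * I)) :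
    L q = log (1 / 2) + m * (2 * Real.pi * I) ∧
    K q = log (1 / 2) + (n + σ : ℤ) * (2 * Real.pi * I) ∧
    ∀ α β : ℂ, 0 < α.re →
      ∫ t in p..q, exp ((α - 1) * K t + (β - 1) * L t) * deriv γ t
        = -(exp (β * (m * (2 * Real.pi * I))) * (exp (α * (n * (2 * Real.pi * I))) -
          exp (α * ((n + σ : ℤ) * (2 * Real.pi * I)))) *
          ((1 / 2 : ℂ) ^ α * incompleteBeta β α (1 / 2))) := by
  obtain ⟨h1, h2, h3⟩ := integral_circle_arc hγ.one_sub hpj hqj hq hK hL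
    (fun t ht => by rw [hKγ t ht]; ring) hLγ (fun t ht => by rw [← hcirc t ht]; ring) hKp hLp
  refine ⟨h2, h1, fun α β hα => ?_⟩
  rw [← h3 β α hα, ← intervalIntegral.integral_neg]
  refine intervalIntegral.integral_congr fun t _ => ?_
  simp only [deriv_const_sub]
  rw [add_comm]
  ring

/-! ### The model loop -/

theorem modelDoubleLoop_of_mem_first {t : ℝ} (ht : t ∈ Icc (0 : ℝ) (1 / 4)) :
    modelDoubleLoop t = 1 - 1 / 2 * exp (2 * Real.pi * I * (4 * t)) := by
  rw [modelDoubleLoop, if_pos ht.2]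

/-- At the left end point the definition still selects the preceding circle; both formulas give
`1/2` there. The same holds for the next two pieces. -/
theorem modelDoubleLoop_of_mem_second {t : ℝ} (ht : t ∈ Icc (1 / 4 : ℝ) (1 / 2)) :
    modelDoubleLoop t = 1 / 2 * exp (2 * Real.pi * I * (4 * t)) := by
  rcases ht.1.eq_or_lt with rfl | h
  · rw [modelDoubleLoop, if_pos le_rfl]
    norm_num
  · rw [modelDoubleLoop, if_neg (not_le.2 h), if_pos ht.2]

theorem modelDoubleLoop_of_mem_third {t : ℝ} (ht : t ∈ Icc (1 / 2 : ℝ) (3 / 4)) :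
    modelDoubleLoop t = 1 - 1 / 2 * exp (-(2 * Real.pi * I * (4 * t))) := by
  rcases ht.1.eq_or_lt with rfl | h
  · have h1 : exp (2 * Real.pi * I * 2) = 1 := by
      rw [← exp_int_mul_two_pi_mul_I 2]
      push_cast
      ring_nf
    rw [modelDoubleLoop, if_neg (by norm_num), if_pos le_rfl]
    norm_num [exp_neg, h1]
  · rw [modelDoubleLoop, if_neg (by linarith), if_neg (not_le.2 h), if_pos ht.2]

theorem modelDoubleLoop_of_mem_fourth {t : ℝ} (ht : t ∈ Icc (3 / 4 : ℝ) 1) :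
    modelDoubleLoop t = 1 / 2 * exp (-(2 * Real.pi * I * (4 * t))) := by
  rcases ht.1.eq_or_lt with rfl | h
  · have h1 : exp (2 * Real.pi * I * 3) = 1 := by
      rw [← exp_int_mul_two_pi_mul_I 3]
      push_cast
      ring_nf
    rw [modelDoubleLoop, if_neg (by norm_num), if_neg (by norm_num), if_pos le_rfl]
    norm_num [exp_neg, h1]
  · rw [modelDoubleLoop, if_neg (by linarith), if_neg (by linarith), if_neg (by linarith)]

theorem isPiecewiseC1_modelDoubleLoop : IsPiecewiseC1 modelDoubleLoop := by
  have h0 : ContDiff ℝ 1 (fun t : ℝ => (t : ℂ)) := ofRealCLM.contDiff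
  have h1 : ContDiffOn ℝ 1 modelDoubleLoop (Icc 0 (1 / 4)) :=
    ContDiffOn.congr (by fun_prop) fun t => modelDoubleLoop_of_mem_first
  have h2 : ContDiffOn ℝ 1 modelDoubleLoop (Icc (1 / 4) (1 / 2)) :=
    ContDiffOn.congr (by fun_prop) fun t => modelDoubleLoop_of_mem_second
  have h3 : ContDiffOn ℝ 1 modelDoubleLoop (Icc (1 / 2) (3 / 4)) :=
    ContDiffOn.congr (by fun_prop) fun t => modelDoubleLoop_of_mem_third
  have h4 : ContDiffOn ℝ 1 modelDoubleLoop (Icc (3 / 4) 1) :=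
    ContDiffOn.congr (by fun_prop) fun t => modelDoubleLoop_of_mem_fourth
  refine ⟨?_, 4, fun i => i / 4, fun i j hij => by dsimp only; gcongr, by simp, by norm_num, ?_⟩
  · have h12 := h1.continuousOn.union_of_isClosed h2.continuousOn isClosed_Icc isClosed_Icc
    rw [Icc_union_Icc_eq_Icc (by norm_num) (by norm_num)] at h12
    have h34 := h3.continuousOn.union_of_isClosed h4.continuousOn isClosed_Icc isClosed_Icc
    rw [Icc_union_Icc_eq_Icc (by norm_num) (by norm_num)] at h34
    have h := h12.union_of_isClosed h34 isClosed_Icc isClosed_Icc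
    rwa [Icc_union_Icc_eq_Icc (by norm_num) (by norm_num)] at h
  · intro i hi
    interval_cases i <;> norm_num <;> assumption

/-- Each circle shifts one logarithm by `±2πi`, and the shifts cancel in pairs. With `A = exp
(2πiα)` and `B = exp (2πiβ)`, the circles around `1` contribute factors `1 - B` and `-A (1 - B)`,
those around `0` contribute `-B (1 - A)` and `1 - A`. Both sums are `(1 - A)(1 - B)`, and the two
half beta integrals add up. -/
theorem modelDoubleLoop_lift {K L : ℝ → ℂ} (hK : ContinuousOn K (Icc 0 1))
    (hL : ContinuousOn L (Icc 0 1)) (hKm : ∀ t ∈ Icc (0 : ℝ) 1, exp (K t) = modelDoubleLoop t)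
    (hLm : ∀ t ∈ Icc (0 : ℝ) 1, exp (L t) = 1 - modelDoubleLoop t) (hK0 : K 0 = log (1 / 2))
    (hL0 : L 0 = log (1 / 2)) :
    K 1 = K 0 ∧ L 1 = L 0 ∧ ∀ α β : ℂ, 0 < α.re → 0 < β.re →
      ∫ t in (0 : ℝ)..1, exp ((α - 1) * K t + (β - 1) * L t) * deriv modelDoubleLoop t
        = (1 - exp (2 * Real.pi * I * α)) * (1 - exp (2 * Real.pi * I * β)) *
          betaIntegral α β := by
  have hm := isPiecewiseC1_modelDoubleLoop.isPiecewiseDiff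
  obtain ⟨a1, a2, a3⟩ := integral_circle_arc (j := 0) (p := 0) (q := 1 / 4) (σ := 1) (m := 0)
    (n := 0) hm (by norm_num) (by norm_num) (by norm_num) hL hK hLm hKm
    (fun t ht => by rw [modelDoubleLoop_of_mem_first ht]; norm_num) (by simp [hL0]) (by simp [hK0])
  obtain ⟨b1, b2, b3⟩ := integral_circle_arc' (j := 1) (p := 1 / 4) (q := 1 / 2) (σ := 1)
    hm (by norm_num) (by norm_num) (by norm_num) hL hK hLm hKm
    (fun t ht => by rw [modelDoubleLoop_of_mem_second ht]; norm_num) a1 a2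
  obtain ⟨c1, c2, c3⟩ := integral_circle_arc (j := 2) (p := 1 / 2) (q := 3 / 4) (σ := -1)
    hm (by norm_num) (by norm_num) (by norm_num) hL hK hLm hKm
    (fun t ht => by rw [modelDoubleLoop_of_mem_third ht]; norm_num) b1 b2
  obtain ⟨d1, d2, d3⟩ := integral_circle_arc' (j := 3) (p := 3 / 4) (q := 1) (σ := -1)
    hm (by norm_num) (by norm_num) (by norm_num) hL hK hLm hKm
    (fun t ht => by rw [modelDoubleLoop_of_mem_fourth ht]; norm_num) c1 c2
  refine ⟨by rw [d2, hK0]; norm_num, by rw [d1, hL0]; norm_num, fun α β hα hβ => ?_⟩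
  have hi : ∀ p q : ℝ, 0 ≤ p → p ≤ q → q ≤ 1 → IntervalIntegrable
      (fun t => exp ((α - 1) * K t + (β - 1) * L t) * deriv modelDoubleLoop t) volume p q := by
    intro p q hp hpq hq
    have hsub : Icc p q ⊆ Icc 0 1 := Icc_subset_Icc hp hq
    exact hm.intervalIntegrable_mul_deriv hp hpq hq
      ((continuousOn_const.mul (hK.mono hsub)).add (continuousOn_const.mul (hL.mono hsub))).cexp
  rw [← intervalIntegral.integral_add_adjacent_intervals (b := 3 / 4)
      (hi _ _ (by norm_num) (by norm_num) (by norm_num))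
      (hi _ _ (by norm_num) (by norm_num) (by norm_num)),
    ← intervalIntegral.integral_add_adjacent_intervals (a := 0) (b := 1 / 2) (c := 3 / 4)
      (hi _ _ (by norm_num) (by norm_num) (by norm_num))
      (hi _ _ (by norm_num) (by norm_num) (by norm_num)),
    ← intervalIntegral.integral_add_adjacent_intervals (a := 0) (b := 1 / 4) (c := 1 / 2)
      (hi _ _ (by norm_num) (by norm_num) (by norm_num))
      (hi _ _ (by norm_num) (by norm_num) (by norm_num)), a3 α β hβ, b3 α β hα, c3 α β hβ,
    d3 α β hα, ← half_cpow_mul_incompleteBeta_add hα hβ, mul_comm _ α, mul_comm _ β]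
  norm_num
  ring

/-! ### Pochhammer's integral -/

theorem IsDoubleLoop.ne {γ : ℝ → ℂ} (hγ : IsDoubleLoop γ) {t : ℝ} (ht : t ∈ Icc (0 : ℝ) 1) :
    γ t ≠ 0 ∧ γ t ≠ 1 := by
  obtain ⟨-, H, -, h0, -, hne, -⟩ := hγ
  rw [← h0 t ht]
  exact hne 0 (by simp) t ht

theorem IsDoubleLoop.isLogAlong {γ : ℝ → ℂ} (hγ : IsDoubleLoop γ) :
    IsLogAlong γ (logAlong γ) :=
  isLogAlong_logAlong hγ.1.1 fun _ ht => (hγ.ne ht).1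

theorem IsDoubleLoop.isLogAlong_one_sub {γ : ℝ → ℂ} (hγ : IsDoubleLoop γ) :
    IsLogAlong (fun s => 1 - γ s) (logAlong fun s => 1 - γ s) :=
  isLogAlong_logAlong (continuousOn_const.sub hγ.1.1) fun _ ht => sub_ne_zero.2 (hγ.ne ht).2.symm

theorem IsLogAlong.eqOn {f K L : ℝ → ℂ} (hK : IsLogAlong f K) (hL : IsLogAlong f L) :
    EqOn K L (Icc 0 1) :=
  exp_lift_eqOn isPreconnected_Icc hK.1 hL.1 (fun t ht => by rw [hK.2.1 t ht, hL.2.1 t ht])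
    (a := 0) (by simp) (by rw [hK.2.2, hL.2.2])

theorem exists_log_lift_homotopy {H : ℝ × ℝ → ℂ} (hH : ContinuousOn H (Icc 0 1 ×ˢ Icc 0 1))
    (hne : ∀ s ∈ Icc (0 : ℝ) 1, ∀ t ∈ Icc (0 : ℝ) 1, H (s, t) ≠ 0)
    (hbase : ∀ s ∈ Icc (0 : ℝ) 1, H (s, 0) ∈ slitPlane) :
    ∃ K : ℝ × ℝ → ℂ, ContinuousOn K (Icc 0 1 ×ˢ Icc 0 1) ∧
      ∀ s ∈ Icc (0 : ℝ) 1, IsLogAlong (fun t => H (s, t)) (fun t => K (s, t)) := by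
  -- Clamping both coordinates extends the homotopy to the whole plane, where a continuous logarithm
  -- exists.
  let cl : ℝ → ℝ := fun t => projIcc (0 : ℝ) 1 zero_le_one t
  have hcl : Continuous cl := continuous_subtype_val.comp continuous_projIcc
  have hclm : ∀ t, cl t ∈ Icc (0 : ℝ) 1 := fun t => (projIcc (0 : ℝ) 1 zero_le_one t).2
  have hcle : ∀ t ∈ Icc (0 : ℝ) 1, cl t = t := fun t ht => by
    simp only [cl, projIcc_of_mem zero_le_one ht]
  have hc : Continuous fun p : ℝ × ℝ => H (cl p.1, cl p.2) :=
    hH.comp_continuous (by fun_prop) fun p => ⟨hclm _, hclm _⟩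
  obtain ⟨K, hK, hKe, hK0⟩ := exists_continuous_log hc (p₀ := (0, 0))
    (fun p => hne _ (hclm _) _ (hclm _)) (exp_log (hne _ (hclm 0) _ (hclm 0)))
  have hKe' : ∀ s ∈ Icc (0 : ℝ) 1, ∀ t ∈ Icc (0 : ℝ) 1, exp (K (s, t)) = H (s, t) := by
    intro s hs t ht
    rw [hKe, hcle s hs, hcle t ht]
  refine ⟨K, hK.continuousOn, fun s hs => ⟨by fun_prop, hKe' s hs, ?_⟩⟩
  -- The lift is normalised at one corner only. As the base points avoid the branch cut, uniqueness
  -- of lifts along the edge `t = 0` gives the principal value at the start of every row.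
  have hb : EqOn (fun s => K (s, 0)) (fun s => log (H (s, 0))) (Icc 0 1) := by
    refine exp_lift_eqOn isPreconnected_Icc (by fun_prop) ?_ (fun t ht => ?_) (a := 0) (by simp) ?_
    · exact ContinuousOn.clog (hH.comp (by fun_prop) fun t ht => ⟨ht, by simp⟩) hbase
    · rw [hKe' t ht 0 (by simp), exp_log (hne t ht 0 (by simp))]
    · rw [hK0, hcle 0 (by simp)]
  exact hb hs

theorem IsDoubleLoop.logAlong_closed_and_integral {γ : ℝ → ℂ} (hγ : IsDoubleLoop γ) :
    logAlong γ 1 = logAlong γ 0 ∧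
    logAlong (fun s => 1 - γ s) 1 = logAlong (fun s => 1 - γ s) 0 ∧
    ∀ α β : ℂ, 0 < α.re → 0 < β.re →
      ∫ t in (0 : ℝ)..1, exp ((α - 1) * logAlong γ t + (β - 1) * logAlong (fun s => 1 - γ s) t) *
          deriv γ t
        = (1 - exp (2 * Real.pi * I * α)) * (1 - exp (2 * Real.pi * I * β)) *
          betaIntegral α β := by
  have hl := hγ.isLogAlong
  have hl' := hγ.isLogAlong_one_sub
  have hpc := hγ.1.isPiecewiseDiff
  obtain ⟨-, H, hH, hH0, hH1, hne, hcl⟩ := hγ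
  obtain ⟨K, hKc, hK⟩ := exists_log_lift_homotopy hH (fun s hs t ht => (hne s hs t ht).1)
    (fun s hs => by
      obtain ⟨r, hr, hr'⟩ := (hcl s hs).2
      rw [hr', ofReal_mem_slitPlane]
      exact hr.1)
  obtain ⟨L, hLc, hL⟩ := exists_log_lift_homotopy (H := fun p => 1 - H p)
    (continuousOn_const.sub hH) (fun s hs t ht => sub_ne_zero.2 (hne s hs t ht).2.symm)
    (fun s hs => by
      obtain ⟨r, hr, hr'⟩ := (hcl s hs).2
      rw [hr', ← ofReal_one, ← ofReal_sub, ofReal_mem_slitPlane]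
      linarith [hr.2])
  have hKe : ∀ s ∈ Icc (0 : ℝ) 1, ∀ t ∈ Icc (0 : ℝ) 1, exp (K (s, t)) = H (s, t) :=
    fun s hs => (hK s hs).2.1
  have hLe : ∀ s ∈ Icc (0 : ℝ) 1, ∀ t ∈ Icc (0 : ℝ) 1, exp (L (s, t)) = 1 - H (s, t) :=
    fun s hs => (hL s hs).2.1
  have hKb : ∀ s ∈ Icc (0 : ℝ) 1, K (s, 0) = log (H (s, 0)) := fun s hs => (hK s hs).2.2
  have hLb : ∀ s ∈ Icc (0 : ℝ) 1, L (s, 0) = log (1 - H (s, 0)) := fun s hs => (hL s hs).2.2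
  have h0 : (0 : ℝ) ∈ Icc (0 : ℝ) 1 := by simp
  have h1 : (1 : ℝ) ∈ Icc (0 : ℝ) 1 := by simp
  have hm0 : modelDoubleLoop 0 = 1 / 2 := by
    rw [modelDoubleLoop_of_mem_first (by norm_num)]
    norm_num
  obtain ⟨hm1, hm2, hm3⟩ := modelDoubleLoop_lift (hK 1 h1).1 (hL 1 h1).1
    (fun t ht => by rw [hKe 1 h1 t ht, hH1 t ht])
    (fun t ht => by rw [hLe 1 h1 t ht, hH1 t ht])
    (by rw [hKb 1 h1, hH1 0 h0, hm0])
    (by rw [hLb 1 h1, hH1 0 h0, hm0]; norm_num)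
  have hcont : ∀ {F : ℝ × ℝ → ℂ}, ContinuousOn F (Icc 0 1 ×ˢ Icc 0 1) → ∀ t ∈ Icc (0 : ℝ) 1,
      ContinuousOn (fun s => F (s, t)) (Icc 0 1) := fun hF t ht =>
    hF.comp (by fun_prop) fun s hs => ⟨hs, ht⟩
  -- Both sides lift the path of base points and agree at `s = 1`, where the model loop closes up;
  -- hence they agree for all `s`, in particular on `γ`.
  have hK01 : EqOn (fun s => K (s, 0)) (fun s => K (s, 1)) (Icc 0 1) :=
    exp_lift_eqOn isPreconnected_Icc (hcont hKc 0 h0) (hcont hKc 1 h1) (fun s hs => by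
      rw [hKe s hs 0 h0, hKe s hs 1 h1, (hcl s hs).1]) h1 hm1.symm
  have hL01 : EqOn (fun s => L (s, 0)) (fun s => L (s, 1)) (Icc 0 1) :=
    exp_lift_eqOn isPreconnected_Icc (hcont hLc 0 h0) (hcont hLc 1 h1) (fun s hs => by
      rw [hLe s hs 0 h0, hLe s hs 1 h1, (hcl s hs).1]) h1 hm2.symm
  have hKγ : EqOn (logAlong γ) (fun t => K (0, t)) (Icc 0 1) := hl.eqOn
    ⟨(hK 0 h0).1, fun t ht => by rw [hKe 0 h0 t ht, hH0 t ht],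
      by simp only; rw [hKb 0 h0, hH0 0 h0]⟩
  have hLγ : EqOn (logAlong fun s => 1 - γ s) (fun t => L (0, t)) (Icc 0 1) := hl'.eqOn
    ⟨(hL 0 h0).1, fun t ht => by simp only; rw [hLe 0 h0 t ht, hH0 t ht],
      by simp only; rw [hLb 0 h0, hH0 0 h0]⟩
  refine ⟨by rw [hKγ h1, hKγ h0]; exact (hK01 h0).symm,
    by rw [hLγ h1, hLγ h0]; exact (hL01 h0).symm, fun α β hα hβ => ?_⟩
  rw [← hm3 α β hα hβ, ← integral_betaBranch_homotopy hKc hLc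
    (fun p hp => by rw [hKe p.1 hp.1 p.2 hp.2, hLe p.1 hp.1 p.2 hp.2]; ring) hK01 hL01
    hpc isPiecewiseC1_modelDoubleLoop.isPiecewiseDiff
    (fun t ht => by rw [hKe 0 h0 t ht, hH0 t ht])
    (fun t ht => by rw [hKe 1 h1 t ht, hH1 t ht]) (α - 1) (β - 1)]
  refine intervalIntegral.integral_congr fun t ht => ?_
  rw [uIcc_of_le zero_le_one] at ht
  rw [hKγ ht, hLγ ht]

/-- Pochhammer's contour integral of `u ^ (α - 1) * (1 - u) ^ (β - 1)` along `γ`. -/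
noncomputable def pochhammerIntegral (γ : ℝ → ℂ) (α β : ℂ) : ℂ :=
  ∫ t in (0 : ℝ)..1, exp ((α - 1) * logAlong γ t + (β - 1) * logAlong (fun s => 1 - γ s) t) *
    deriv γ t

theorem IsDoubleLoop.intervalIntegrable_pochhammer {γ : ℝ → ℂ} (hγ : IsDoubleLoop γ) (α β : ℂ) :
    IntervalIntegrable (fun t => exp ((α - 1) * logAlong γ t +
      (β - 1) * logAlong (fun s => 1 - γ s) t) * deriv γ t) volume 0 1 :=
  hγ.1.isPiecewiseDiff.intervalIntegrable_mul_deriv le_rfl zero_le_one le_rfl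
    ((continuousOn_const.mul hγ.isLogAlong.1).add
      (continuousOn_const.mul hγ.isLogAlong_one_sub.1)).cexp

theorem IsDoubleLoop.pochhammerIntegral_add {γ : ℝ → ℂ} (hγ : IsDoubleLoop γ) (α β : ℂ) :
    pochhammerIntegral γ (α + 1) β + pochhammerIntegral γ α (β + 1) = pochhammerIntegral γ α β := by
  rw [pochhammerIntegral, pochhammerIntegral, pochhammerIntegral,
    ← intervalIntegral.integral_add (hγ.intervalIntegrable_pochhammer _ _)
      (hγ.intervalIntegrable_pochhammer _ _)]
  refine intervalIntegral.integral_congr fun t ht => ?_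
  rw [uIcc_of_le zero_le_one] at ht
  have h1 := hγ.isLogAlong.2.1 t ht
  have h2 := hγ.isLogAlong_one_sub.2.1 t ht
  have e1 : ∀ k l : ℂ, exp ((α + 1 - 1) * k + (β - 1) * l)
      = exp ((α - 1) * k + (β - 1) * l) * exp k := fun k l => by rw [← exp_add]; ring_nf
  have e2 : ∀ k l : ℂ, exp ((α - 1) * k + (β + 1 - 1) * l)
      = exp ((α - 1) * k + (β - 1) * l) * exp l := fun k l => by rw [← exp_add]; ring_nf
  rw [e1, e2, h1, h2]
  ring

/-- The difference of the two sides is the integral of the derivative of `u ^ α (1 - u) ^ β`, which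
vanishes because this branch returns to its initial value along the double loop. -/
theorem IsDoubleLoop.mul_pochhammerIntegral {γ : ℝ → ℂ} (hγ : IsDoubleLoop γ) (α β : ℂ) :
    α * pochhammerIntegral γ α (β + 1) = β * pochhammerIntegral γ (α + 1) β := by
  have hl := hγ.isLogAlong
  have hl' := hγ.isLogAlong_one_sub
  obtain ⟨hc1, hc2, -⟩ := hγ.logAlong_closed_and_integral
  obtain ⟨-, -, s, hs, hd⟩ := hγ.1.isPiecewiseDiff
  have hi1 := (hγ.intervalIntegrable_pochhammer α (β + 1)).const_mul α
  have hi2 := (hγ.intervalIntegrable_pochhammer (α + 1) β).const_mul β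
  have h := integral_eq_of_hasDerivAt_off_countable_of_le
    (fun t => exp (α * logAlong γ t + β * logAlong (fun s => 1 - γ s) t)) _ zero_le_one hs
    ((continuousOn_const.mul hl.1).add (continuousOn_const.mul hl'.1)).cexp ?_ (hi1.sub hi2)
  · rw [intervalIntegral.integral_sub hi1 hi2, hc1, hc2, sub_self,
      intervalIntegral.integral_const_mul, intervalIntegral.integral_const_mul] at h
    exact sub_eq_zero.1 h
  · rintro t ⟨ht, hts⟩
    have hnhds : Icc (0 : ℝ) 1 ∈ 𝓝 t := Icc_mem_nhds ht.1 ht.2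
    have htI := Ioo_subset_Icc_self ht
    have hγ' : HasDerivAt γ (deriv γ t) t := (hd t ⟨ht, hts⟩).hasDerivAt
    have hK' := hasDerivAt_of_exp_eq (hl.1.continuousAt hnhds) hγ'
      (by filter_upwards [hnhds] with u hu using hl.2.1 u hu)
    have hL' := hasDerivAt_of_exp_eq (hl'.1.continuousAt hnhds) (hγ'.const_sub 1)
      (by filter_upwards [hnhds] with u hu using hl'.2.1 u hu)
    convert! ((hK'.const_mul α).add (hL'.const_mul β)).cexp using 1
    have h1 : γ t ≠ 0 := (hγ.ne htI).1
    have h2 : 1 - γ t ≠ 0 := sub_ne_zero.2 (hγ.ne htI).2.symm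
    have e1 : ∀ k l : ℂ, exp ((α + 1 - 1) * k + (β - 1) * l)
        = exp (α * k + β * l) / exp l := fun k l => by rw [← exp_sub]; ring_nf
    have e2 : ∀ k l : ℂ, exp ((α - 1) * k + (β + 1 - 1) * l)
        = exp (α * k + β * l) / exp k := fun k l => by rw [← exp_sub]; ring_nf
    rw [e1, e2, hl.2.1 t htI, hl'.2.1 t htI]
    simp only [Pi.add_apply]
    field_simp
    ring

theorem exp_two_pi_I_mul_add_one (α : ℂ) :
    exp (2 * Real.pi * I * (α + 1)) = exp (2 * Real.pi * I * α) := by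
  rw [mul_add, mul_one, exp_add, exp_two_pi_mul_I, mul_one]

/-- With `P` for the contour integral, the contiguity relations combine to `β P(α, β) = (α + β) P(α,
β + 1)` and its mirror image. The product of Gamma functions satisfies the same recursions and the
exponential factors are periodic, so induction lowers the real parts from the half-planes where the
beta integral converges. -/
theorem IsDoubleLoop.pochhammerIntegral_eq {γ : ℝ → ℂ} (hγ : IsDoubleLoop γ) {α β : ℂ}
    (hα : ∀ n : ℤ, α ≠ n) (hβ : ∀ n : ℤ, β ≠ n) (hαβ : ∀ n : ℕ, α + β ≠ -n) :
    pochhammerIntegral γ α β = (1 - exp (2 * Real.pi * I * α)) * (1 - exp (2 * Real.pi * I * β)) *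
      (Gamma α * Gamma β / Gamma (α + β)) := by
  have shift : ∀ z : ℂ, (∀ n : ℤ, z ≠ n) → ∀ n : ℤ, z + 1 ≠ n := fun z hz n h =>
    hz (n - 1) (by push_cast; linear_combination h)
  have shift' : ∀ z : ℂ, (∀ n : ℕ, z ≠ -n) → ∀ n : ℕ, z + 1 ≠ -n := fun z hz n h =>
    hz (n + 1) (by push_cast; linear_combination h)
  obtain ⟨n, hn⟩ := exists_nat_gt (-α.re)
  obtain ⟨m, hm⟩ := exists_nat_gt (-β.re)
  induction n generalizing α with
  | zero =>
    induction m generalizing β with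
    | zero =>
      rw [pochhammerIntegral, hγ.logAlong_closed_and_integral.2.2 α β (by simpa using hn)
        (by simpa using hm), betaIntegral_eq_Gamma_mul_div _ _ (by simpa using hn)
        (by simpa using hm)]
    | succ m ih =>
      have hβ0 : β ≠ 0 := by simpa using hβ 0
      have hs0 : α + β ≠ 0 := by simpa using hαβ 0
      have h := ih (shift β hβ) (by push_cast at hm; rw [add_re, one_re]; linarith)
        (fun n => by rw [← add_assoc]; exact shift' _ hαβ n)
      have hrec : β * pochhammerIntegral γ α β = (α + β) * pochhammerIntegral γ α (β + 1) := by
        linear_combination -β * hγ.pochhammerIntegral_add α β - hγ.mul_pochhammerIntegral α β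
      rw [← add_assoc, Gamma_add_one _ hβ0, Gamma_add_one _ hs0, exp_two_pi_I_mul_add_one] at h
      have hΓ := Gamma_ne_zero hαβ
      rw [h] at hrec
      apply mul_left_cancel₀ hβ0
      rw [hrec]
      field_simp
  | succ n ih =>
    have hα0 : α ≠ 0 := by simpa using hα 0
    have hs0 : α + β ≠ 0 := by simpa using hαβ 0
    have h := ih (shift α hα) (fun n => by rw [add_right_comm]; exact shift' _ hαβ n)
      (by push_cast at hn; rw [add_re, one_re]; linarith)
    have hrec : α * pochhammerIntegral γ α β = (α + β) * pochhammerIntegral γ (α + 1) β := by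
      linear_combination -α * hγ.pochhammerIntegral_add α β + hγ.mul_pochhammerIntegral α β
    rw [add_right_comm, Gamma_add_one _ hα0, Gamma_add_one _ hs0, exp_two_pi_I_mul_add_one] at h
    have hΓ := Gamma_ne_zero hαβ
    rw [h] at hrec
    apply mul_left_cancel₀ hα0
    rw [hrec]
    field_simp

/-! ### Analytic families of continuous functions -/

section ContinuousFamily

variable {X : Type*} [TopologicalSpace X]

open Classical in
/-- The element `t ↦ g (φ t * x)` of `C(X, ℂ)` (and `0` if this function is not continuous). -/
noncomputable def compMul (φ : C(X, ℂ)) (g : ℂ → ℂ) (x : ℂ) : C(X, ℂ) :=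
  if h : Continuous fun t => g (φ t * x) then ⟨_, h⟩ else 0

theorem compMul_apply (φ : C(X, ℂ)) {g : ℂ → ℂ} {Ω : Set ℂ} (hg : ContinuousOn g Ω) {x : ℂ}
    (hx : ∀ t, φ t * x ∈ Ω) (t : X) : compMul φ g x t = g (φ t * x) := by
  have h : Continuous fun t => g (φ t * x) := hg.comp_continuous (by fun_prop) hx
  rw [compMul, dif_pos h]
  rfl

theorem continuousOn_compMul (φ : C(X, ℂ)) {g : ℂ → ℂ} {Ω : Set ℂ} (hg : ContinuousOn g Ω) :
    ContinuousOn (compMul φ g) {x : ℂ | ∀ t, φ t * x ∈ Ω} := by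
  set V := {x : ℂ | ∀ t, φ t * x ∈ Ω} with hV
  let f : C(V × X, ℂ) := ⟨fun p => g (φ p.2 * p.1),
    hg.comp_continuous (by fun_prop) fun p => p.1.2 p.2⟩
  rw [continuousOn_iff_continuous_domRestrict]
  convert f.curry.continuous using 1
  ext x t
  exact compMul_apply φ hg x.2 t

variable [CompactSpace X]

theorem isOpen_forall_mul_mem (φ : C(X, ℂ)) {Ω : Set ℂ} (hΩ : IsOpen Ω) :
    IsOpen {x : ℂ | ∀ t, φ t * x ∈ Ω} := by
  have h1 : Continuous fun x : ℂ => x • φ := by fun_prop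
  have h2 := (ContinuousMap.isOpen_setOfPred_mapsTo (X := X) isCompact_univ hΩ).preimage h1
  convert h2 using 1
  ext x
  simp [MapsTo, mul_comm]

/-- The Cauchy integral of a continuous Banach-valued function is analytic. Evaluation at `t`
commutes with it, so the scalar Cauchy formula at each `t` shows that it reproduces `compMul φ g`.
-/
theorem analyticOnNhd_compMul (φ : C(X, ℂ)) {g : ℂ → ℂ} {Ω : Set ℂ} (hΩ : IsOpen Ω)
    (hg : DifferentiableOn ℂ g Ω) : AnalyticOnNhd ℂ (compMul φ g) {x : ℂ | ∀ t, φ t * x ∈ Ω} := by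
  intro x₀ hx₀
  obtain ⟨R, hR, hRV⟩ := Metric.nhds_basis_closedBall.mem_iff.1
    ((isOpen_forall_mul_mem φ hΩ).mem_nhds hx₀)
  lift R to NNReal using hR.le
  have hcont := (continuousOn_compMul φ hg.continuousOn).mono hRV
  have hcirc : CircleIntegrable (compMul φ g) x₀ R :=
    (hcont.mono Metric.sphere_subset_closedBall).circleIntegrable R.2
  have han := (hasFPowerSeriesOn_cauchy_integral hcirc (by exact_mod_cast hR)).analyticAt
  refine han.congr ?_
  filter_upwards [Metric.ball_mem_nhds x₀ hR] with w hw
  ext t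
  have hd : ∀ z ∈ Metric.closedBall x₀ (R : ℝ), DifferentiableAt ℂ (fun z => g (φ t * z)) z := by
    intro z hz
    exact DifferentiableAt.comp z (hg.differentiableAt (hΩ.mem_nhds (hRV hz t))) (by fun_prop)
  have hC := two_pi_I_inv_smul_circleIntegral_sub_inv_smul_of_differentiable_on_off_countable
    countable_empty hw (fun z hz => (hd z hz).continuousAt.continuousWithinAt)
    (fun z hz => hd z (Metric.ball_subset_closedBall hz.1))
  rw [compMul_apply φ hg.continuousOn (hRV (Metric.ball_subset_closedBall hw)), ← hC,
    ContinuousMap.smul_apply]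
  congr 1
  have hint : CircleIntegrable (fun z => (z - w)⁻¹ • compMul φ g z) x₀ R := by
    refine ContinuousOn.circleIntegrable R.2 (ContinuousOn.smul (f := fun z => (z - w)⁻¹) ?_
      (hcont.mono Metric.sphere_subset_closedBall))
    refine ContinuousOn.inv₀ (by fun_prop) fun z hz => sub_ne_zero.2 ?_
    rintro rfl
    rw [Metric.mem_sphere] at hz
    rw [Metric.mem_ball, hz] at hw
    exact lt_irrefl _ hw
  have hcomm := (ContinuousMap.evalCLM ℂ t : C(X, ℂ) →L[ℂ] ℂ).intervalIntegral_comp_comm hint.out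
  refine Eq.trans hcomm.symm ?_
  rw [circleIntegral]
  refine intervalIntegral.integral_congr fun θ _ => ?_
  simp only [map_smul, ContinuousMap.evalCLM_apply]
  rw [compMul_apply φ hg.continuousOn (x := circleMap x₀ R θ)
    (hRV (circleMap_mem_closedBall x₀ R.2 θ))]

theorem hasSum_compMul [Nonempty X] (φ : C(X, ℂ)) {g : ℂ → ℂ} {Ω : Set ℂ} (hg : ContinuousOn g Ω)
    (hΩ : Metric.ball 0 1 ⊆ Ω) {c : ℕ → ℂ}
    (hc : ∀ z : ℂ, ‖z‖ < 1 → HasSum (fun n => c n * z ^ n) (g z)) {x : ℂ} (hx : ‖φ‖ * ‖x‖ < 1) :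
    Summable (fun n => ‖(c n * x ^ n) • φ ^ n‖) ∧
      HasSum (fun n => (c n * x ^ n) • φ ^ n) (compMul φ g x) := by
  have hs : Summable (fun n => ‖(c n * x ^ n) • φ ^ n‖) := by
    have h1 := (hc (‖φ‖ * ‖x‖ : ℝ) (by
      rw [norm_real, Real.norm_eq_abs, abs_of_nonneg (by positivity)]; exact hx)).summable.norm
    refine h1.of_nonneg_of_le (fun n => norm_nonneg _) fun n => ?_
    rw [norm_smul, norm_mul, norm_mul (c n), norm_pow x, norm_pow (_ : ℂ), norm_real, Real.norm_eq_abs,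
      abs_of_nonneg (by positivity : 0 ≤ ‖φ‖ * ‖x‖), mul_pow, mul_assoc, mul_comm (‖φ‖ ^ n)]
    gcongr
    exact norm_pow_le _ _
  refine ⟨hs, ?_⟩
  have hlt : ∀ t, ‖φ t * x‖ < 1 := fun t => by
    rw [norm_mul]
    exact lt_of_le_of_lt (by gcongr; exact φ.norm_coe_le_norm t) hx
  have hsum := hs.of_norm.hasSum
  suffices h : compMul φ g x = ∑' n, (c n * x ^ n) • φ ^ n by rwa [h]
  ext t
  have h1 := (ContinuousMap.evalCLM ℂ t : C(X, ℂ) →L[ℂ] ℂ).hasSum hsum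
  have h2 := hc (φ t * x) (hlt t)
  rw [compMul_apply φ hg (fun t => hΩ (mem_ball_zero_iff.2 (hlt t)))]
  refine h2.unique (Eq.subst (motive := fun f => HasSum f _) (funext fun n => ?_) h1)
  simp [mul_pow]
  ring

end ContinuousFamily

/-! ### The binomial series and the series of Euler's integral -/

/-- The binomial coefficient `(c)_n / n!`. -/
noncomputable def binomCoeff (c : ℂ) (n : ℕ) : ℂ := (ascPochhammer ℂ n).eval c / n.factorial

theorem hasSum_one_sub_cpow_neg (c : ℂ) {z : ℂ} (hz : ‖z‖ < 1) :
    HasSum (fun n => binomCoeff c n * z ^ n) ((1 - z) ^ (-c)) := by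
  have h := (one_div_one_sub_cpow_hasFPowerSeriesOnBall_zero c).hasSum (y := z)
    (by simpa [enorm_eq_nnnorm, ← NNReal.coe_lt_coe] using hz)
  rw [zero_add, one_div, ← cpow_neg] at h
  refine Eq.subst (motive := fun f => HasSum f _) (funext fun n => ?_) h
  have h1 : Ring.choose (c + n - 1) n = binomCoeff c n := by
    rw [binomCoeff, ← Ring.multichoose_eq, eq_div_iff (by exact_mod_cast n.factorial_ne_zero),
      mul_comm, ← nsmul_eq_mul, Ring.factorial_nsmul_multichoose_eq_ascPochhammer,
      Polynomial.ascPochhammer_smeval_eq_eval]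
  simp [FormalMultilinearSeries.ofScalars, h1]

theorem hasSum_eulerIntegral {d s : ℂ} (hd : 0 < d.re) (hs : 0 < s.re) (c : ℂ) {z : ℂ}
    (hz : ‖z‖ < 1) :
    HasSum (fun n : ℕ => binomCoeff c n * betaIntegral (d + n) s * z ^ n)
      (eulerIntegral d s c z) := by
  have hw := betaIntegral_convergent hd hs
  have hb : ∀ v ∈ uIoc (0 : ℝ) 1, ‖(v : ℂ)‖ ≤ 1 ∧ (v : ℂ) ≠ 0 := fun v hv => by
    rw [uIoc_of_le zero_le_one] at hv
    rw [norm_real, Real.norm_eq_abs, abs_of_pos hv.1]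
    exact ⟨hv.2, by exact_mod_cast hv.1.ne'⟩
  have hsum := (hasSum_one_sub_cpow_neg c (z := (‖z‖ : ℝ)) (by simpa using hz)).summable.norm
  simp only [norm_mul, norm_pow, norm_real, norm_norm] at hsum
  have h := intervalIntegral.hasSum_integral_of_dominated_convergence (μ := volume) (a := 0) (b := 1)
    (F := fun (n : ℕ) (v : ℝ) => ((v : ℂ) ^ (d - 1) * (1 - (v : ℂ)) ^ (s - 1)) *
      (binomCoeff c n * (v * z) ^ n))
    (f := fun v : ℝ => ((v : ℂ) ^ (d - 1) * (1 - (v : ℂ)) ^ (s - 1)) * (1 - v * z) ^ (-c))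
    (fun n v => ‖(v : ℂ) ^ (d - 1) * (1 - (v : ℂ)) ^ (s - 1)‖ * (‖binomCoeff c n‖ * ‖z‖ ^ n))
    (fun n => (hw.mul_continuousOn (by fun_prop)).def'.aestronglyMeasurable)
    (fun n => Eventually.of_forall fun v hv => ?_)
    (Eventually.of_forall fun v hv => hsum.mul_left _) ?_
    (Eventually.of_forall fun v hv => ?_)
  · refine Eq.subst (motive := fun f => HasSum f _) (funext fun n => ?_) h
    rw [betaIntegral, mul_right_comm, ← intervalIntegral.integral_const_mul]
    refine (intervalIntegral.integral_congr_ae (Eventually.of_forall fun v hv => ?_)).symm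
    rw [add_sub_right_comm, cpow_add _ _ (hb v hv).2, cpow_natCast, mul_pow]
    ring
  · rw [norm_mul, norm_mul (binomCoeff c n), norm_pow, norm_mul (v : ℂ)]
    gcongr
    exact mul_le_of_le_one_left (norm_nonneg _) (hb v hv).1
  · simp_rw [tsum_mul_left]
    exact hw.norm.mul_const _
  · refine (hasSum_one_sub_cpow_neg c ?_).mul_left _
    rw [norm_mul]
    exact (mul_le_of_le_one_left (norm_nonneg _) (hb v hv).1).trans_lt hz

/-! ### Convergence of Horn's series -/

theorem exists_le_mul_pow_of_ratio_le {u : ℕ → ℝ} (hu : ∀ n, 0 ≤ u n) {q : ℝ} (hq : 0 < q)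
    (h : ∀ᶠ n in atTop, u (n + 1) ≤ q * u n) : ∃ C, 0 ≤ C ∧ ∀ n, u n ≤ C * q ^ n := by
  obtain ⟨N, hN⟩ := eventually_atTop.1 h
  have hs : ∀ n ≤ N, u n ≤ (∑ k ∈ Finset.range (N + 1), u k / q ^ k) * q ^ n := by
    intro n hn
    rw [← div_le_iff₀ (by positivity)]
    exact Finset.single_le_sum (f := fun k => u k / q ^ k)
      (fun k _ => div_nonneg (hu k) (by positivity)) (Finset.mem_range.2 (by omega))
  refine ⟨∑ k ∈ Finset.range (N + 1), u k / q ^ k,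
    Finset.sum_nonneg fun k _ => div_nonneg (hu k) (by positivity), fun n => ?_⟩
  rcases le_total n N with hn | hn
  · exact hs n hn
  · induction n, hn using Nat.le_induction with
    | base => exact hs N le_rfl
    | succ n hn ih =>
      calc u (n + 1) ≤ q * u n := hN n hn
        _ ≤ q * ((∑ k ∈ Finset.range (N + 1), u k / q ^ k) * q ^ n) := by gcongr
        _ = _ := by ring

theorem exists_norm_ascPochhammer_le (z : ℂ) {q : ℝ} (hq : 1 < q) :
    ∃ C, 0 ≤ C ∧ ∀ n : ℕ, ‖(ascPochhammer ℂ n).eval z‖ ≤ C * q ^ n * n.factorial := by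
  have hq0 : 0 < q := by linarith
  obtain ⟨C, hC, h⟩ := exists_le_mul_pow_of_ratio_le
    (u := fun n => ‖(ascPochhammer ℂ n).eval z‖ / n.factorial) (fun n => by positivity) hq0 (by
      filter_upwards [eventually_ge_atTop ⌈‖z‖ / (q - 1)⌉₊] with n hn
      have h1 : ‖z‖ ≤ n * (q - 1) := (div_le_iff₀ (by linarith)).1 (Nat.ceil_le.1 hn)
      have h2 : ‖z + n‖ ≤ q * (n + 1) := by
        refine (norm_add_le _ _).trans ?_
        rw [norm_natCast]
        nlinarith
      rw [ascPochhammer_succ_eval, norm_mul, Nat.factorial_succ, Nat.cast_mul,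
        div_le_iff₀ (by positivity)]
      have h3 : q * (‖(ascPochhammer ℂ n).eval z‖ / n.factorial) *
          (((n + 1 : ℕ) : ℝ) * n.factorial) = ‖(ascPochhammer ℂ n).eval z‖ * (q * (n + 1)) := by
        field_simp
        push_cast
        ring
      rw [h3]
      gcongr)
  refine ⟨C, hC, fun n => ?_⟩
  have := h n
  rwa [div_le_iff₀ (by positivity)] at this

/-- No condition on `z` is needed: a vanishing Pochhammer symbol has inverse `0`. The threshold on
`n` below is chosen so that `n + 1 ≤ q (n - ‖z‖)`. -/
theorem exists_norm_ascPochhammer_inv_le (z : ℂ) {q : ℝ} (hq : 1 < q) :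
    ∃ C, 0 ≤ C ∧ ∀ n : ℕ, n.factorial * ‖(ascPochhammer ℂ n).eval z‖⁻¹ ≤ C * q ^ n := by
  have hq0 : 0 < q := by linarith
  refine exists_le_mul_pow_of_ratio_le (fun n => by positivity) hq0 ?_
  filter_upwards [eventually_ge_atTop ⌈(1 + q * ‖z‖) / (q - 1)⌉₊] with n hn
  have h1 : 1 + q * ‖z‖ ≤ n * (q - 1) := (div_le_iff₀ (by linarith)).1 (Nat.ceil_le.1 hn)
  have h2 : (n : ℝ) - ‖z‖ ≤ ‖z + n‖ := by
    have := norm_sub_norm_le (n : ℂ) (-z)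
    rw [norm_natCast, norm_neg, sub_neg_eq_add, add_comm (n : ℂ)] at this
    exact this
  have h4 : (n : ℝ) + 1 ≤ q * ‖z + n‖ := by nlinarith
  have h5 : 0 < ‖z + n‖ := by
    by_contra! h
    nlinarith [(Nat.cast_nonneg n : (0 : ℝ) ≤ n)]
  have h6 : ((n : ℝ) + 1) * ‖z + n‖⁻¹ ≤ q := by
    rw [← div_eq_mul_inv, div_le_iff₀ h5]
    exact h4
  rw [ascPochhammer_succ_eval, norm_mul, Nat.factorial_succ, mul_inv]
  push_cast
  calc ((n : ℝ) + 1) * n.factorial * (‖(ascPochhammer ℂ n).eval z‖⁻¹ * ‖z + n‖⁻¹)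
      = (((n : ℝ) + 1) * ‖z + n‖⁻¹) * (n.factorial * ‖(ascPochhammer ℂ n).eval z‖⁻¹) := by ring
    _ ≤ q * (n.factorial * ‖(ascPochhammer ℂ n).eval z‖⁻¹) := by gcongr

theorem pochhammerZ_natCast (z : ℂ) (n : ℕ) : pochhammerZ z n = (ascPochhammer ℂ n).eval z := rfl

theorem pochhammerZ_neg_natCast (z : ℂ) (n : ℕ) :
    pochhammerZ z (-(n : ℤ)) = (-1) ^ n / (ascPochhammer ℂ n).eval (1 - z) := by
  cases n with
  | zero => simpa using pochhammerZ_natCast z 0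
  | succ n => rfl

/-- Up to a subexponential factor absorbed in `q`, the symbol behaves like `(i-j)!` for `i ≥ j` and
like `1/(j-i)!` for `j ≥ i`. After normalisation this is at most `1` in the first case and `j.choose
i` in the second; the sum covers both. -/
theorem exists_norm_pochhammerZ_sub_le (z : ℂ) {q : ℝ} (hq : 1 < q) :
    ∃ C, 0 ≤ C ∧ ∀ i j : ℕ, ‖pochhammerZ z ((i : ℤ) - j)‖ * (j.factorial / i.factorial)
      ≤ C * q ^ (i + j) * (1 + j.choose i) := by
  obtain ⟨C₁, hC₁, h₁⟩ := exists_norm_ascPochhammer_le z hq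
  obtain ⟨C₂, hC₂, h₂⟩ := exists_norm_ascPochhammer_inv_le (1 - z) hq
  have hq0 : 0 < q := by linarith
  refine ⟨C₁ + C₂, by positivity, fun i j => ?_⟩
  rcases le_total j i with hij | hij
  · obtain ⟨k, rfl⟩ := Nat.exists_eq_add_of_le hij
    have hk : ((j + k : ℕ) : ℤ) - j = k := by push_cast; ring
    have hf : (k.factorial : ℝ) * (j.factorial / (j + k).factorial) ≤ 1 := by
      rw [← mul_div_assoc, div_le_one (by positivity)]
      exact_mod_cast (mul_comm k.factorial _).trans_le
        (Nat.le_of_dvd (Nat.factorial_pos _) (Nat.factorial_mul_factorial_dvd_factorial_add j k))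
    rw [hk, pochhammerZ_natCast]
    calc ‖(ascPochhammer ℂ k).eval z‖ * ((j.factorial : ℝ) / (j + k).factorial)
        ≤ C₁ * q ^ k * k.factorial * ((j.factorial : ℝ) / (j + k).factorial) := by
          gcongr
          exact h₁ k
      _ = C₁ * q ^ k * (k.factorial * ((j.factorial : ℝ) / (j + k).factorial)) := by ring
      _ ≤ (C₁ + C₂) * q ^ (j + k + j) * (1 + j.choose (j + k)) := by
          gcongr ?_ * ?_ * ?_
          · linarith
          · exact pow_le_pow_right₀ hq.le (by omega)
          · exact hf.trans (by simp)
  · obtain ⟨k, rfl⟩ := Nat.exists_eq_add_of_le hij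
    have hk : (i : ℤ) - ((i + k : ℕ) : ℤ) = -(k : ℤ) := by push_cast; ring
    have hf : ((i + k).factorial : ℝ) / i.factorial = k.factorial * (i + k).choose i := by
      rw [div_eq_iff (by positivity)]
      exact_mod_cast (by
        rw [← Nat.add_choose_mul_factorial_mul_factorial i k, Nat.choose_symm_add]
        ring)
    rw [hk, pochhammerZ_neg_natCast, norm_div, norm_pow, norm_neg, norm_one, one_pow, one_div, hf]
    calc ‖(ascPochhammer ℂ k).eval (1 - z)‖⁻¹ * (k.factorial * (i + k).choose i)
        = k.factorial * ‖(ascPochhammer ℂ k).eval (1 - z)‖⁻¹ * (i + k).choose i := by ring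
      _ ≤ C₂ * q ^ k * (i + k).choose i := by
          gcongr ?_ * _
          exact h₂ k
      _ ≤ (C₁ + C₂) * q ^ (i + (i + k)) * (1 + (i + k).choose i) := by
          gcongr ?_ * ?_ * ?_
          · linarith
          · exact pow_le_pow_right₀ hq.le (by omega)
          · linarith

theorem summable_choose_mul_pow {X Y : ℝ} (hX : 0 ≤ X) (hY : 0 ≤ Y) (hX1 : X < 1)
    (hXY : Y * (X + 1) < 1) :
    Summable fun p : ℕ × ℕ => (1 + (p.2.choose p.1 : ℝ)) * (X ^ p.1 * Y ^ p.2) := by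
  have hY1 : Y < 1 := by nlinarith
  have h1 : Summable fun p : ℕ × ℕ => X ^ p.1 * Y ^ p.2 :=
    summable_mul_of_summable_norm (by simpa [abs_of_nonneg hX] using summable_geometric_of_lt_one hX hX1)
      (by simpa [abs_of_nonneg hY] using summable_geometric_of_lt_one hY hY1)
  -- Summing over `i` first collapses the binomial theorem to a geometric series in `Y (X + 1)`,
  -- which accounts for the shape of the convergence region.
  have hfin : ∀ j : ℕ, HasSum (fun i : ℕ => (j.choose i : ℝ) * (X ^ i * Y ^ j))
      ((Y * (X + 1)) ^ j) := by
    intro j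
    have h := hasSum_sum_of_ne_finset_zero (L := SummationFilter.unconditional ℕ) (f := fun i : ℕ => (j.choose i : ℝ) * (X ^ i * Y ^ j))
      (s := Finset.range (j + 1)) (fun i hi => by
        rw [Finset.mem_range, not_lt] at hi
        rw [Nat.choose_eq_zero_of_lt (by omega)]
        simp)
    convert h using 1
    rw [mul_pow, add_pow, Finset.mul_sum]
    refine Finset.sum_congr rfl fun i _ => ?_
    rw [one_pow]
    ring
  have h2 : Summable fun p : ℕ × ℕ => (p.1.choose p.2 : ℝ) * (X ^ p.2 * Y ^ p.1) := by
    rw [summable_prod_of_nonneg (fun p => by positivity)]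
    refine ⟨fun j => (hfin j).summable, ?_⟩
    simp_rw [fun j => (hfin j).tsum_eq]
    exact summable_geometric_of_lt_one (by positivity) hXY
  have h3 := h1.add ((Equiv.prodComm ℕ ℕ).summable_iff.2 h2)
  refine h3.congr fun p => ?_
  simp only [Function.comp, Equiv.prodComm_apply, Prod.fst_swap, Prod.snd_swap]
  ring

theorem summable_norm_hornH2Term (a b c d e : ℂ) {p : ℂ × ℂ} (hp : p ∈ hornH2Region) :
    Summable fun ij => ‖hornH2Term a b c d e p.1 p.2 ij‖ := by
  obtain ⟨x, y⟩ := p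
  obtain ⟨hx, hy⟩ := hp
  simp only at hx hy ⊢
  rw [← one_div, lt_div_iff₀ (by positivity)] at hy
  -- The exponent `3` counts the Pochhammer symbols that cost a factor `q`: those of `a, b, e` for
  -- the index `i`, and those of `a, c, d` for `j`.
  obtain ⟨q, hq1, hqX, hqY⟩ : ∃ q : ℝ, 1 < q ∧ q ^ 3 * ‖x‖ < 1 ∧
      q ^ 3 * ‖y‖ * (q ^ 3 * ‖x‖ + 1) < 1 := by
    have e1 : ∀ᶠ q : ℝ in 𝓝 1, q ^ 3 * ‖x‖ < 1 :=
      ContinuousAt.eventually_lt (by fun_prop) continuousAt_const (by simpa using hx)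
    have e2 : ∀ᶠ q : ℝ in 𝓝 1, q ^ 3 * ‖y‖ * (q ^ 3 * ‖x‖ + 1) < 1 :=
      ContinuousAt.eventually_lt (by fun_prop) continuousAt_const (by simpa using hy)
    have e3 := ((e1.and e2).filter_mono nhdsWithin_le_nhds).and
      (self_mem_nhdsWithin : Ioi (1 : ℝ) ∈ 𝓝[>] 1)
    obtain ⟨q, hq, hq1⟩ := e3.exists
    exact ⟨q, hq1, hq⟩
  have hq0 : 0 < q := by linarith
  obtain ⟨Ca, hCa, ha⟩ := exists_norm_pochhammerZ_sub_le a hq1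
  obtain ⟨Cb, hCb, hb⟩ := exists_norm_ascPochhammer_le b hq1
  obtain ⟨Cc, hCc, hc⟩ := exists_norm_ascPochhammer_le c hq1
  obtain ⟨Cd, hCd, hd⟩ := exists_norm_ascPochhammer_le d hq1
  obtain ⟨Ce, hCe, he⟩ := exists_norm_ascPochhammer_inv_le e hq1
  have hsum := (summable_choose_mul_pow (X := q ^ 3 * ‖x‖) (Y := q ^ 3 * ‖y‖) (by positivity)
    (by positivity) hqX hqY).mul_left (Ca * Cb * Cc * Cd * Ce)
  refine hsum.of_nonneg_of_le (fun _ => norm_nonneg _) ?_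
  rintro ⟨i, j⟩
  simp only [hornH2Term, pochhammerZ_natCast, norm_mul, norm_div, norm_pow, norm_natCast]
  set A := ‖pochhammerZ a ((i : ℤ) - j)‖
  set B := ‖(ascPochhammer ℂ i).eval b‖
  set C := ‖(ascPochhammer ℂ j).eval c‖
  set D := ‖(ascPochhammer ℂ j).eval d‖
  set E := ‖(ascPochhammer ℂ i).eval e‖
  have hi : (0 : ℝ) < i.factorial := by positivity
  have hj : (0 : ℝ) < j.factorial := by positivity
  calc A * B * C * D / (E * i.factorial * j.factorial) * ‖x‖ ^ i * ‖y‖ ^ j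
      = (A * (j.factorial / i.factorial)) * (B / i.factorial) * (C / j.factorial) *
        (D / j.factorial) * (i.factorial * E⁻¹) * (‖x‖ ^ i * ‖y‖ ^ j) := by
        rw [div_eq_mul_inv _ (E * _ * _), mul_inv, mul_inv]
        field_simp
    _ ≤ (Ca * q ^ (i + j) * (1 + j.choose i)) * (Cb * q ^ i) * (Cc * q ^ j) * (Cd * q ^ j) *
        (Ce * q ^ i) * (‖x‖ ^ i * ‖y‖ ^ j) := by
        gcongr ?_ * ?_ * ?_ * ?_ * ?_ * _
        · exact ha i j
        · exact (div_le_iff₀ hi).2 (hb i)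
        · exact (div_le_iff₀ hj).2 (hc j)
        · exact (div_le_iff₀ hj).2 (hd j)
        · exact he i
    _ = Ca * Cb * Cc * Cd * Ce * ((1 + (j.choose i : ℝ)) *
        ((q ^ 3 * ‖x‖) ^ i * (q ^ 3 * ‖y‖) ^ j)) := by ring

theorem isOpen_hornH2Region : IsOpen hornH2Region := by
  have h1 : IsOpen {p : ℂ × ℂ | ‖p.1‖ < 1} := isOpen_lt (by fun_prop) (by fun_prop)
  have h2 : IsOpen {p : ℂ × ℂ | ‖p.2‖ < (‖p.1‖ + 1)⁻¹} := by
    refine isOpen_lt (by fun_prop) (Continuous.inv₀ (by fun_prop) fun p => ?_)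
    positivity
  exact h1.inter h2

theorem hornH2Term_smul (a b c d e x y s : ℂ) (ij : ℕ × ℕ) :
    hornH2Term a b c d e (s * x) (s * y) ij
      = hornH2Term a b c d e x y ij * s ^ (ij.1 + ij.2) := by
  simp only [hornH2Term]
  ring

/-- A function which is analytic on a product of open sets that are star-shaped about `0`, and which
is the sum of Horn's series near the origin, is its sum at all points of the convergence region. -/
theorem hasSum_hornH2Term_of_eventually {a b c d e : ℂ} {V W : Set ℂ} (hV : IsOpen V)
    (hW : IsOpen W) (hVs : StarConvex ℝ 0 V) (hWs : StarConvex ℝ 0 W) {F : ℂ × ℂ → ℂ}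
    (hF : AnalyticOnNhd ℂ F (V ×ˢ W))
    (h0 : ∀ᶠ p in 𝓝 (0 : ℂ × ℂ), HasSum (hornH2Term a b c d e p.1 p.2) (F p))
    {p : ℂ × ℂ} (hp : p ∈ (V ×ˢ W) ∩ hornH2Region) :
    HasSum (hornH2Term a b c d e p.1 p.2) (F p) := by
  -- On the complex line through `p` the series is a power series in `s`. Absolute convergence at
  -- some `ρ > 1` makes `s = 1` an interior point of its disc.
  obtain ⟨ρ, hρ1, hρ⟩ : ∃ ρ : ℝ, 1 < ρ ∧ ((ρ : ℂ) * p.1, (ρ : ℂ) * p.2) ∈ hornH2Region := by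
    have hc : Continuous fun ρ : ℝ => ((ρ : ℂ) * p.1, (ρ : ℂ) * p.2) := by fun_prop
    have e1 : ∀ᶠ ρ : ℝ in 𝓝 1, ((ρ : ℂ) * p.1, (ρ : ℂ) * p.2) ∈ hornH2Region :=
      hc.continuousAt.eventually_mem (isOpen_hornH2Region.mem_nhds (by simpa using hp.2))
    obtain ⟨ρ, h1, h2⟩ := ((e1.filter_mono nhdsWithin_le_nhds).and
      (self_mem_nhdsWithin : Ioi (1 : ℝ) ∈ 𝓝[>] 1)).exists
    exact ⟨ρ, h2, h1⟩
  have hsum := summable_norm_hornH2Term a b c d e hρ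
  set T : Set ℂ := {s : ℂ | (s * p.1, s * p.2) ∈ V ×ˢ W} ∩ Metric.ball 0 ρ with hT
  have hline : AnalyticOnNhd ℂ (fun s : ℂ => (s * p.1, s * p.2)) univ := fun s _ =>
    AnalyticAt.prod (by fun_prop) (by fun_prop)
  have hlinec : Continuous fun s : ℂ => (s * p.1, s * p.2) := by fun_prop
  have hTo : IsOpen T := ((hV.prod hW).preimage hlinec).inter Metric.isOpen_ball
  have hTs : StarConvex ℝ 0 T := by
    rw [starConvex_zero_iff]
    intro s hs t ht0 ht1
    refine ⟨⟨?_, ?_⟩, ?_⟩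
    · have := hVs.smul_mem hs.1.1 ht0 ht1
      simpa [mul_assoc] using this
    · have := hWs.smul_mem hs.1.2 ht0 ht1
      simpa [mul_assoc] using this
    · have h := hs.2
      rw [mem_ball_zero_iff] at h ⊢
      rw [norm_smul, Real.norm_eq_abs, abs_of_nonneg ht0]
      nlinarith [norm_nonneg s]
  have h1T : (1 : ℂ) ∈ T := ⟨by simpa using hp.1, by simpa using hρ1⟩
  have h0T : (0 : ℂ) ∈ T := by simpa using hTs.smul_mem h1T le_rfl zero_le_one
  have hbound : ∀ ij : ℕ × ℕ, ∀ s ∈ Metric.ball (0 : ℂ) ρ,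
      ‖hornH2Term a b c d e (s * p.1) (s * p.2) ij‖
        ≤ ‖hornH2Term a b c d e (ρ * p.1) (ρ * p.2) ij‖ := by
    intro ij s hs
    rw [mem_ball_zero_iff] at hs
    rw [hornH2Term_smul, hornH2Term_smul, norm_mul, norm_mul, norm_pow, norm_pow, norm_real,
      Real.norm_eq_abs, abs_of_pos (by linarith)]
    gcongr
  have hS : DifferentiableOn ℂ (fun s : ℂ => ∑' ij, hornH2Term a b c d e (s * p.1) (s * p.2) ij)
      (Metric.ball 0 ρ) := by
    refine differentiableOn_tsum_of_summable_norm hsum (fun ij => ?_) Metric.isOpen_ball hbound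
    simp_rw [hornH2Term_smul]
    fun_prop
  have heq : EqOn (fun s : ℂ => F (s * p.1, s * p.2))
      (fun s : ℂ => ∑' ij, hornH2Term a b c d e (s * p.1) (s * p.2) ij) T := by
    refine AnalyticOnNhd.eqOn_of_preconnected_of_eventuallyEq (z₀ := 0) ?_
      ((hS.mono inter_subset_right).analyticOnNhd hTo)
      (hTs.isPathConnected h0T).isConnected.isPreconnected h0T ?_
    · intro s hs
      exact AnalyticAt.comp (f := fun s : ℂ => (s * p.1, s * p.2)) (hF _ hs.1) (hline s trivial)
    · have ht : Tendsto (fun s : ℂ => (s * p.1, s * p.2)) (𝓝 0) (𝓝 0) :=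
        hlinec.tendsto' _ _ (by simp)
      filter_upwards [ht.eventually h0] with s hs using hs.tsum_eq.symm
  have h1 := heq h1T
  simp only [one_mul] at h1
  rw [Prod.mk.eta] at h1
  rw [h1]
  exact (summable_norm_hornH2Term a b c d e hp.2).of_norm.hasSum

/-! ### Gamma function and Pochhammer symbols -/

theorem Gamma_add_natCast {z : ℂ} (hz : ∀ n : ℕ, z ≠ -n) (n : ℕ) :
    Gamma (z + n) = Gamma z * (ascPochhammer ℂ n).eval z := by
  rw [← Gamma_add_nat_div_Gamma_eq z hz, mul_div_cancel₀ _ (Gamma_ne_zero hz)]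

/-- For negative index, `Γ(z) = Γ(z-n) (z-n)_n` and `(z-n)_n = (-1)^n (1-z)_n`, matching the
convention for `(z)_{-n}`. -/
theorem Gamma_add_intCast {z : ℂ} (hz : ∀ n : ℤ, z ≠ n) (k : ℤ) :
    Gamma (z + k) = Gamma z * pochhammerZ z k := by
  obtain ⟨n, rfl | rfl⟩ := k.eq_nat_or_neg
  · rw [pochhammerZ_natCast]
    exact_mod_cast Gamma_add_natCast (fun m h => hz (-m) (by exact_mod_cast h)) n
  · have h1 := Gamma_add_natCast (z := z + (-(n : ℤ) : ℤ))
      (fun m h => hz (n - m) (by push_cast at h ⊢; linear_combination h)) n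
    have h2 : (ascPochhammer ℂ n).eval (z + (-(n : ℤ) : ℤ))
        = (-1) ^ n * (ascPochhammer ℂ n).eval (1 - z) := by
      have h3 := descPochhammer_eval_eq_ascPochhammer ℂ (z - 1) n
      have h4 := ascPochhammer_eval_neg_eq_descPochhammer ℂ (z - 1) n
      rw [neg_sub] at h4
      rw [h4, h3, ← mul_assoc, ← mul_pow]
      norm_num
      ring_nf
    have h5 : z + ((-(n : ℤ) : ℤ) : ℂ) + n = z := by push_cast; ring
    rw [h5, h2] at h1
    have h6 : Gamma z ≠ 0 := Gamma_ne_zero fun m h => hz (-m) (by push_cast; exact h)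
    have h7 : (ascPochhammer ℂ n).eval (1 - z) ≠ 0 := by
      intro h
      rw [h] at h1
      exact h6 (by simpa using h1)
    rw [pochhammerZ_neg_natCast]
    conv_rhs => rw [h1]
    have h8 : ((-1 : ℂ) ^ n) * (-1) ^ n = 1 := by rw [← mul_pow]; norm_num
    field_simp
    linear_combination -Gamma (z + ((-(n : ℤ) : ℤ) : ℂ)) * h8

/-! ### The contour integral as a function of `x` and `y` -/

theorem exists_weighted_integral_clm {w : ℝ → ℂ} (hw : IntervalIntegrable w volume 0 1) :
    ∃ Λ : C(Icc (0 : ℝ) 1, ℂ) →L[ℂ] ℂ, ∀ f,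
      Λ f = ∫ t in (0 : ℝ)..1, w t * IccExtend zero_le_one f t := by
  have hint : ∀ f : C(Icc (0 : ℝ) 1, ℂ),
      IntervalIntegrable (fun t => w t * IccExtend zero_le_one f t) volume 0 1 := fun f =>
    hw.mul_continuousOn (f.continuous.Icc_extend').continuousOn
  refine ⟨LinearMap.mkContinuous
    { toFun := fun f => ∫ t in (0 : ℝ)..1, w t * IccExtend zero_le_one f t
      map_add' := fun f g => ?_
      map_smul' := fun c f => ?_ } (∫ t in (0 : ℝ)..1, ‖w t‖) fun f => ?_, fun f => rfl⟩
  · rw [← intervalIntegral.integral_add (hint f) (hint g)]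
    refine intervalIntegral.integral_congr fun t _ => ?_
    simp [IccExtend, mul_add]
  · rw [RingHom.id_apply, smul_eq_mul, ← intervalIntegral.integral_const_mul]
    refine intervalIntegral.integral_congr fun t _ => ?_
    simp [IccExtend]
    ring
  · simp only [LinearMap.coe_mk, AddHom.coe_mk]
    rw [← intervalIntegral.integral_mul_const]
    refine intervalIntegral.norm_integral_le_of_norm_le zero_le_one
      (Eventually.of_forall fun t _ => ?_) (hw.norm.mul_const _)
    rw [norm_mul]
    gcongr
    exact f.norm_coe_le_norm _

theorem isOpen_starConvex_forall_mul_mem_cutPlane (φ : C(Icc (0 : ℝ) 1, ℂ)) :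
    IsOpen {x : ℂ | ∀ t, φ t * x ∈ cutPlane} ∧ StarConvex ℝ 0 {x : ℂ | ∀ t, φ t * x ∈ cutPlane} := by
  refine ⟨isOpen_forall_mul_mem φ isOpen_cutPlane, ?_⟩
  rw [starConvex_zero_iff]
  intro x hx s hs0 hs1 t
  have := mul_mem_cutPlane (hx t) (v := s) ⟨hs0, hs1⟩
  rwa [real_smul, mul_left_comm]

theorem differentiableOn_one_sub_cpow (c : ℂ) :
    DifferentiableOn ℂ (fun z : ℂ => (1 - z) ^ c) cutPlane := fun z hz =>
  (DifferentiableAt.cpow_const (by fun_prop) (one_sub_mem_slitPlane hz)).differentiableWithinAt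

theorem integral_innerIntegrand (a c d e y u : ℂ) :
    ∫ v in (0 : ℝ)..1, innerIntegrand a c d e y u v
      = eulerIntegral d (e - a - d) c ((u⁻¹ - 1) * y) := by
  refine intervalIntegral.integral_congr fun v _ => ?_
  simp only [innerIntegrand]
  rw [show (u⁻¹ - 1) * (v : ℂ) * y = v * ((u⁻¹ - 1) * y) by ring]

/-- The phases do not see the integer shifts of the exponents, and `Γ(e-a+j)` occurs both in
Pochhammer's integral and in the denominator of the beta function. Non-integrality of `a` and `e -
a` makes the phase factors nonzero; the condition on `e` excludes the poles of `Γ(e+i)`. -/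
theorem hornH2Term_eq {a b c d e : ℂ} (hd : 0 < d.re) (head : 0 < (e - a - d).re)
    (ha : ∀ n : ℤ, a ≠ n) (hea : ∀ n : ℤ, e - a ≠ n) (he : ∀ n : ℕ, e ≠ -(n : ℂ))
    {γ : ℝ → ℂ} (hγ : IsDoubleLoop γ) (x y : ℂ) (i j : ℕ) :
    hornH2Term a b c d e x y (i, j)
      = Gamma e / (Gamma (e - a - d) * Gamma a * Gamma d)
        * (1 / ((1 - exp (2 * Real.pi * I * a)) * (1 - exp (2 * Real.pi * I * (e - a)))))
        * ((binomCoeff b i * x ^ i) * (binomCoeff c j * betaIntegral (d + j) (e - a - d) * y ^ j) *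
          pochhammerIntegral γ (a + ((i : ℤ) - j : ℤ)) (e - a + j)) := by
  have hE : ∀ z : ℂ, (∀ n : ℤ, z ≠ n) → 1 - exp (2 * Real.pi * I * z) ≠ 0 := by
    intro z hz h
    obtain ⟨n, hn⟩ := exp_eq_one_iff.1 (sub_eq_zero.1 h).symm
    refine hz n (mul_left_cancel₀ two_pi_I_ne_zero ?_)
    rw [hn]
    ring
  have hexp : ∀ (z : ℂ) (n : ℤ), exp (2 * Real.pi * I * (z + n)) = exp (2 * Real.pi * I * z) := by
    intro z n
    rw [mul_add, exp_add, mul_comm _ (n : ℂ), exp_int_mul_two_pi_mul_I, mul_one]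
  have hE1 := hE a ha
  have hE2 := hE (e - a) hea
  have nat_of_int : ∀ {z : ℂ}, (∀ n : ℤ, z ≠ n) → ∀ n : ℕ, z ≠ -n := fun hz n h =>
    hz (-n) (by push_cast; exact h)
  have hd' : ∀ n : ℕ, d ≠ -n := fun n h => by
    rw [h, neg_re, natCast_re] at hd
    linarith [(Nat.cast_nonneg n : (0 : ℝ) ≤ n)]
  have hei : ∀ n : ℕ, e + i ≠ -n := fun n h =>
    he (n + i) (by push_cast; linear_combination h)
  have hs : a + ((i : ℤ) - j : ℤ) + (e - a + j) = e + i := by push_cast; ring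
  have heaj : ∀ n : ℤ, e - a + j ≠ n := fun n h =>
    hea (n - j) (by push_cast; linear_combination h)
  have hP := hγ.pochhammerIntegral_eq (α := a + ((i : ℤ) - j : ℤ)) (β := e - a + j)
    (fun n h => ha (n - ((i : ℤ) - j)) (by push_cast at h ⊢; linear_combination h)) heaj
    (by rw [hs]; exact hei)
  have hexp2 := hexp (e - a) j
  rw [Int.cast_natCast] at hexp2
  rw [hs, hexp, hexp2, Gamma_add_intCast ha, Gamma_add_natCast he] at hP
  have hB := betaIntegral_eq_Gamma_mul_div (d + j) (e - a - d)
    (by rw [add_re, natCast_re]; positivity) head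
  rw [show d + j + (e - a - d) = e - a + j by ring, Gamma_add_natCast hd'] at hB
  have n1 : Gamma a ≠ 0 := Gamma_ne_zero (nat_of_int ha)
  have n2 : Gamma d ≠ 0 := Gamma_ne_zero hd'
  have n3 : Gamma e ≠ 0 := Gamma_ne_zero he
  have n4 : Gamma (e - a - d) ≠ 0 := Gamma_ne_zero_of_re_pos head
  have n5 : Gamma (e - a + j) ≠ 0 := Gamma_ne_zero (nat_of_int heaj)
  have n6 : (ascPochhammer ℂ i).eval e ≠ 0 := fun h => by
    have := Gamma_add_natCast he i
    rw [h, mul_zero] at this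
    exact Gamma_ne_zero hei this
  have n7 : (i.factorial : ℂ) ≠ 0 := by exact_mod_cast i.factorial_ne_zero
  have n8 : (j.factorial : ℂ) ≠ 0 := by exact_mod_cast j.factorial_ne_zero
  simp only [hornH2Term, pochhammerZ_natCast]
  rw [hP, hB, binomCoeff, binomCoeff]
  generalize 1 - exp (2 * Real.pi * I * a) = E₁ at hE1 ⊢
  generalize 1 - exp (2 * Real.pi * I * (e - a)) = E₂ at hE2 ⊢
  field_simp

theorem hasSum_mul_of_summable_norm {A : Type*} [NormedRing A] [CompleteSpace A] {u v : ℕ → A}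
    {f g : A} (hu : Summable fun n => ‖u n‖) (hv : Summable fun n => ‖v n‖)
    (hf : HasSum u f) (hg : HasSum v g) : HasSum (fun ij : ℕ × ℕ => u ij.1 * v ij.2) (f * g) :=
  hf.mul hg (summable_mul_of_summable_norm hu hv)

theorem hasSum_clm_mul {A : Type*} [NormedRing A] [NormedAlgebra ℂ A] [CompleteSpace A]
    (Λ : A →L[ℂ] ℂ) {c₁ c₂ : ℕ → ℂ} {u v : ℕ → A} {f g : A}
    (hu : Summable fun n => ‖c₁ n • u n‖) (hv : Summable fun n => ‖c₂ n • v n‖)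
    (hf : HasSum (fun n => c₁ n • u n) f) (hg : HasSum (fun n => c₂ n • v n) g) :
    HasSum (fun ij : ℕ × ℕ => c₁ ij.1 * c₂ ij.2 * Λ (u ij.1 * v ij.2)) (Λ (f * g)) := by
  have h := Λ.hasSum (hasSum_mul_of_summable_norm hu hv hf hg)
  refine Eq.subst (motive := fun f => HasSum f _) (funext fun ij => ?_) h
  simp only [smul_mul_smul_comm, map_smul, smul_eq_mul]

section ContinuousFamily

variable {X : Type*} [TopologicalSpace X] [CompactSpace X]

theorem analyticOnNhd_clm_compMul_mul (Λ : C(X, ℂ) →L[ℂ] ℂ) (φ ψ : C(X, ℂ)) {g₁ g₂ : ℂ → ℂ}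
    {Ω : Set ℂ} (hΩ : IsOpen Ω) (hg₁ : DifferentiableOn ℂ g₁ Ω) (hg₂ : DifferentiableOn ℂ g₂ Ω) :
    AnalyticOnNhd ℂ (fun p : ℂ × ℂ => Λ (compMul φ g₁ p.1 * compMul ψ g₂ p.2))
      ({x : ℂ | ∀ t, φ t * x ∈ Ω} ×ˢ {y : ℂ | ∀ t, ψ t * y ∈ Ω}) := by
  intro p hp
  have h1 : AnalyticAt ℂ (fun p : ℂ × ℂ => compMul φ g₁ p.1) p :=
    AnalyticAt.fun_comp (f := fun p : ℂ × ℂ => p.1) (analyticOnNhd_compMul φ hΩ hg₁ p.1 hp.1)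
      analyticAt_fst
  have h2 : AnalyticAt ℂ (fun p : ℂ × ℂ => compMul ψ g₂ p.2) p :=
    AnalyticAt.fun_comp (f := fun p : ℂ × ℂ => p.2) (analyticOnNhd_compMul ψ hΩ hg₂ p.2 hp.2)
      analyticAt_snd
  have h3 : AnalyticAt ℂ (fun p : ℂ × ℂ => compMul φ g₁ p.1 * compMul ψ g₂ p.2) p :=
    AnalyticAt.fun_mul h1 h2
  exact AnalyticAt.fun_comp (Λ.analyticAt _) h3

theorem eventually_hasSum_clm_compMul_mul [Nonempty X] (Λ : C(X, ℂ) →L[ℂ] ℂ) (φ ψ : C(X, ℂ))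
    {g₁ g₂ : ℂ → ℂ} {Ω : Set ℂ} (hg₁ : ContinuousOn g₁ Ω) (hg₂ : ContinuousOn g₂ Ω)
    (hΩ : Metric.ball 0 1 ⊆ Ω) {c₁ c₂ : ℕ → ℂ}
    (h₁ : ∀ z : ℂ, ‖z‖ < 1 → HasSum (fun n => c₁ n * z ^ n) (g₁ z))
    (h₂ : ∀ z : ℂ, ‖z‖ < 1 → HasSum (fun n => c₂ n * z ^ n) (g₂ z)) :
    ∀ᶠ p : ℂ × ℂ in 𝓝 0, HasSum (fun ij : ℕ × ℕ =>
      (c₁ ij.1 * p.1 ^ ij.1) * (c₂ ij.2 * p.2 ^ ij.2) * Λ (φ ^ ij.1 * ψ ^ ij.2))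
      (Λ (compMul φ g₁ p.1 * compMul ψ g₂ p.2)) := by
  have e1 : ∀ᶠ p : ℂ × ℂ in 𝓝 0, ‖φ‖ * ‖p.1‖ < 1 :=
    ContinuousAt.eventually_lt (by fun_prop) continuousAt_const (by simp)
  have e2 : ∀ᶠ p : ℂ × ℂ in 𝓝 0, ‖ψ‖ * ‖p.2‖ < 1 :=
    ContinuousAt.eventually_lt (by fun_prop) continuousAt_const (by simp)
  filter_upwards [e1, e2] with p hp1 hp2
  obtain ⟨s1, k1⟩ := hasSum_compMul φ hg₁ hΩ h₁ hp1
  obtain ⟨s2, k2⟩ := hasSum_compMul ψ hg₂ hΩ h₂ hp2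
  exact hasSum_clm_mul Λ (c₁ := fun i => c₁ i * p.1 ^ i) (c₂ := fun j => c₂ j * p.2 ^ j)
    (u := fun i => φ ^ i) (v := fun j => ψ ^ j) s1 s2 k1 k2

end ContinuousFamily

/-- The functional on `C([0, 1], ℂ)` given by integration against the weight
`u ^ (a - 1) * (1 - u) ^ (s - 1) du` pulled back by a double loop. -/
theorem IsDoubleLoop.exists_clm {γ : ℝ → ℂ} (hγ : IsDoubleLoop γ) (a s : ℂ) :
    ∃ (Λ : C(Icc (0 : ℝ) 1, ℂ) →L[ℂ] ℂ) (φ ψ : C(Icc (0 : ℝ) 1, ℂ)),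
      (∀ t, φ t = γ t) ∧ (∀ t, ψ t = (γ t)⁻¹ - 1) ∧
      (∀ i j : ℕ, Λ (φ ^ i * ψ ^ j) = pochhammerIntegral γ (a + ((i : ℤ) - j : ℤ)) (s + j)) ∧
      ∀ (f : C(Icc (0 : ℝ) 1, ℂ)) (F : ℝ → ℂ),
        (∀ t : Icc (0 : ℝ) 1, F t = exp ((a - 1) * logAlong γ t) *
          exp ((s - 1) * logAlong (fun s => 1 - γ s) t) * f t * deriv γ t) →
        IntervalIntegrable F volume 0 1 ∧ Λ f = ∫ t in (0 : ℝ)..1, F t := by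
  have hw := hγ.intervalIntegrable_pochhammer a s
  obtain ⟨Λ, hΛ⟩ := exists_weighted_integral_clm hw
  have hc : ContinuousOn γ (Icc 0 1) := hγ.1.1
  have hc1 : Continuous fun t : Icc (0 : ℝ) 1 => γ t := hc.domRestrict
  have hc2 : Continuous fun t : Icc (0 : ℝ) 1 => (γ t)⁻¹ - 1 :=
    ((hc.inv₀ fun t ht => (hγ.ne ht).1).sub continuousOn_const).domRestrict
  refine ⟨Λ, ⟨fun t => γ t, hc1⟩, ⟨fun t => (γ t)⁻¹ - 1, hc2⟩,
    fun t => rfl, fun t => rfl, fun i j => ?_, fun f F hF => ?_⟩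
  · rw [hΛ, pochhammerIntegral]
    refine intervalIntegral.integral_congr fun t ht => ?_
    rw [uIcc_of_le zero_le_one] at ht
    have hk := hγ.isLogAlong.2.1 t ht
    have hl := hγ.isLogAlong_one_sub.2.1 t ht
    -- Because `(1-u)/u` is the exponential of the difference of the two logarithms, multiplying by
    -- `φ ^ i * ψ ^ j` just shifts the exponents of the weight.
    have hψ : (γ t)⁻¹ - 1 = exp (logAlong (fun s => 1 - γ s) t - logAlong γ t) := by
      rw [exp_sub, hk, hl, sub_div, div_self (hγ.ne ht).1, one_div]
    rw [IccExtend_of_mem _ _ ht]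
    simp only [ContinuousMap.mul_apply, ContinuousMap.pow_apply, ContinuousMap.coe_mk]
    rw [hψ, ← hk, ← exp_nat_mul, ← exp_nat_mul, mul_right_comm, ← exp_add, ← exp_add]
    congr 2
    push_cast
    ring
  · have hpt : EqOn (fun t => exp ((a - 1) * logAlong γ t +
        (s - 1) * logAlong (fun s => 1 - γ s) t) * deriv γ t * IccExtend zero_le_one f t)
        F (uIcc 0 1) := by
      intro t ht
      rw [uIcc_of_le zero_le_one] at ht
      simp only
      rw [IccExtend_of_mem _ _ ht, hF ⟨t, ht⟩, exp_add]
      ring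
    refine ⟨IntervalIntegrable.congr (fun t ht => hpt (uIoc_subset_uIcc ht)) ?_, ?_⟩
    · exact hw.mul_continuousOn f.continuous.Icc_extend'.continuousOn
    · rw [hΛ, intervalIntegral.integral_congr hpt]

/-- The product form of the domain comes from the integrand being a product of a function of `u x`
and a function of `(u⁻¹ - 1) y`. No smallness is required for the integral formula, only that the
curve keeps both arguments in the cut plane. -/
theorem exists_analytic_outerIntegral {a b c d e : ℂ} (hd : 0 < d.re) (head : 0 < (e - a - d).re)
    (ha : ∀ n : ℤ, a ≠ n) (hea : ∀ n : ℤ, e - a ≠ n) (he : ∀ n : ℕ, e ≠ -(n : ℂ))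
    {γ : ℝ → ℂ} (hγ : IsDoubleLoop γ) :
    ∃ (V W : Set ℂ) (F : ℂ × ℂ → ℂ), IsOpen V ∧ IsOpen W ∧ StarConvex ℝ 0 V ∧ StarConvex ℝ 0 W ∧
      (∀ x, x ∈ V ↔ ∀ t ∈ Icc (0 : ℝ) 1, γ t * x ∈ cutPlane) ∧
      (∀ y, y ∈ W ↔ ∀ t ∈ Icc (0 : ℝ) 1, ((γ t)⁻¹ - 1) * y ∈ cutPlane) ∧
      AnalyticOnNhd ℂ F (V ×ˢ W) ∧
      (∀ᶠ p in 𝓝 (0 : ℂ × ℂ), HasSum (hornH2Term a b c d e p.1 p.2) (F p)) ∧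
      ∀ x ∈ V, ∀ y ∈ W,
        IntervalIntegrable (outerIntegrand a b c d e x y γ) volume 0 1 ∧
        F (x, y) = Gamma e / (Gamma (e - a - d) * Gamma a * Gamma d)
          * (1 / ((1 - exp (2 * Real.pi * I * a)) * (1 - exp (2 * Real.pi * I * (e - a)))))
          * ∫ t in (0 : ℝ)..1, outerIntegrand a b c d e x y γ t := by
  have hterm := fun x y i j =>
    hornH2Term_eq (b := b) (c := c) hd head ha hea he hγ x y i j
  generalize Gamma e / (Gamma (e - a - d) * Gamma a * Gamma d)
    * (1 / ((1 - exp (2 * Real.pi * I * a)) * (1 - exp (2 * Real.pi * I * (e - a))))) = C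
    at hterm ⊢
  obtain ⟨Λ, φ, ψ, hφ, hψ, hΛ, hint⟩ := hγ.exists_clm a (e - a)
  have hg₁ := differentiableOn_one_sub_cpow (-b)
  have hg₂ := differentiableOn_eulerIntegral hd head c
  obtain ⟨hVo, hVs⟩ := isOpen_starConvex_forall_mul_mem_cutPlane φ
  obtain ⟨hWo, hWs⟩ := isOpen_starConvex_forall_mul_mem_cutPlane ψ
  refine ⟨{x : ℂ | ∀ t, φ t * x ∈ cutPlane}, {y : ℂ | ∀ t, ψ t * y ∈ cutPlane},
    fun p => C * Λ (compMul φ (fun z => (1 - z) ^ (-b)) p.1 *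
      compMul ψ (eulerIntegral d (e - a - d) c) p.2), hVo, hWo, hVs, hWs,
    fun x => ?_, fun y => ?_, ?_, ?_, ?_⟩
  · simp only [mem_ofPred_eq, hφ]
    exact Subtype.forall
  · simp only [mem_ofPred_eq, hψ]
    exact Subtype.forall
  · intro p hp
    exact AnalyticAt.fun_mul analyticAt_const
      (analyticOnNhd_clm_compMul_mul Λ φ ψ isOpen_cutPlane hg₁ hg₂ p hp)
  · filter_upwards [eventually_hasSum_clm_compMul_mul Λ φ ψ hg₁.continuousOn hg₂.continuousOn
      ball_subset_cutPlane (fun z hz => hasSum_one_sub_cpow_neg b hz)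
      (fun z hz => hasSum_eulerIntegral hd head c hz)] with p hp
    refine Eq.subst (motive := fun f => HasSum f _) (funext fun ij => ?_) (hp.mul_left C)
    rw [← Prod.mk.eta (p := ij), hterm, hΛ]
  · intro x hx y hy
    obtain ⟨h1, h2⟩ := hint (compMul φ (fun z => (1 - z) ^ (-b)) x *
      compMul ψ (eulerIntegral d (e - a - d) c) y) (outerIntegrand a b c d e x y γ) fun t => by
        rw [outerIntegrand, ContinuousMap.mul_apply, compMul_apply φ hg₁.continuousOn hx,
          compMul_apply ψ hg₂.continuousOn hy, integral_innerIntegrand, hφ, hψ]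
        ring
    exact ⟨h1, congrArg (C * ·) h2⟩

theorem mainTheorem2 (a b c d e : ℂ) (hd : 0 < d.re) (head : 0 < (e - a - d).re)
    (ha : ∀ n : ℤ, a ≠ n) (hea : ∀ n : ℤ, e - a ≠ n) (he : ∀ n : ℕ, e ≠ -(n : ℂ))
    (γ : ℝ → ℂ) (hγ : IsDoubleLoop γ) (x y : ℂ)
    (hx : ∀ t ∈ Set.Icc (0 : ℝ) 1, ∀ r : ℝ, 1 ≤ r → γ t * x ≠ r)
    (hy : ∀ t ∈ Set.Icc (0 : ℝ) 1, ∀ r : ℝ, 1 ≤ r → ((γ t)⁻¹ - 1) * y ≠ r) :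
    (∃ w, IsHornH2Value a b c d e x y w) ∧
    (∀ t ∈ Set.Icc (0 : ℝ) 1,
      IntervalIntegrable (innerIntegrand a c d e y (γ t)) MeasureTheory.volume 0 1) ∧
    IntervalIntegrable (outerIntegrand a b c d e x y γ) MeasureTheory.volume 0 1 ∧
    hornH2 a b c d e x y =
      Complex.Gamma e / (Complex.Gamma (e - a - d) * Complex.Gamma a * Complex.Gamma d)
        * (1 / ((1 - Complex.exp (2 * Real.pi * Complex.I * a))
            * (1 - Complex.exp (2 * Real.pi * Complex.I * (e - a)))))
        * ∫ t in (0 : ℝ)..1, outerIntegrand a b c d e x y γ t := by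
  obtain ⟨V, W, F, hV, hW, hVs, hWs, hVm, hWm, hF, h0, hint⟩ :=
    exists_analytic_outerIntegral (b := b) (c := c) hd head ha hea he hγ
  have hxV : x ∈ V := (hVm x).2 hx
  have hyW : y ∈ W := (hWm y).2 hy
  obtain ⟨hi, hFxy⟩ := hint x hxV y hyW
  -- The product `V ×ˢ W` serves as the star-shaped domain of the continuation, with the contour
  -- integral as the analytic function on it.
  have hval : IsHornH2Value a b c d e x y (F (x, y)) :=
    ⟨V ×ˢ W, F, hV.prod hW, hVs.prod hWs, ⟨hxV, hyW⟩, hF,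
      fun p hp => hasSum_hornH2Term_of_eventually hV hW hVs hWs hF h0 hp, rfl⟩
  refine ⟨⟨_, hval⟩, fun t ht => ?_, hi, by rw [hval.hornH2_eq, hFxy]⟩
  refine (intervalIntegrable_eulerIntegral hd head c (hy t ht)).congr fun v _ => ?_
  simp only [innerIntegrand]
  rw [show ((γ t)⁻¹ - 1) * (v : ℂ) * y = v * (((γ t)⁻¹ - 1) * y) by ring]
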